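/- Let $k$ be a commutative ring, and let $d\ge 0$ and $n\ge 1$ be integers. For a finitely generated projective $k$-module $V$ let $\Gamma^dV=(V^{\otimes d})^{\mathfrak S_d}$ be the module of symmetric tensors (with $\Gamma^0V=k$) and $\Lambda^dV$ the $d$-th exterior power. Let $\Gamma^d\mathsf P_k$ be the $k$-linear category whose objects are the finitely generated projective $k$-modules, with morphisms $\operatorname{Hom}_{\Gamma^d\mathsf P_k}(V,W)=\Gamma^d\operatorname{Hom}_k(V,W)$ and with composition induced by composing $k$-linear maps in each tensor factor. Let $\operatorname{Rep}\Gamma^d_k$ be the category of $k$-linear functors from $\Gamma^d\mathsf P_k$ to $k$-modules. Both $\Gamma^d$ and $\Lambda^d$ are objects of $\operatorname{Rep}\Gamma^d_k$, where $f\in\Gamma^d\operatorname{Hom}_k(V,W)$ acts through the map $V^{\otimes d}\to W^{\otimes d}$ that it defines. *External tensor product.* For $X\in\operatorname{Rep}\Gamma^a_k$ and $Y\in\operatorname{Rep}\Gamma^b_k$ let $X\otimes Y\in\operatorname{Rep}\Gamma^{a+b}_k$ be given by $(X\otimes Y)(V)=X(V)\otimes_k Y(V)$, with morphisms acting via the inclusion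 $\Gamma^{a+b}H=(H^{\otimes a+b})^{\mathfrak S_{a+b}}\subseteq (H^{\otimes a+b})^{\mathfrak S_a\times\mathfrak S_b}\cong\Gamma^aH\otimes_k\Gamma^bH$ for $H=\operatorname{Hom}_k(V,W)$. Let $\Lambda(n,d)$ be the set of sequences $\lambda=(\lambda_1,\dots,\lambda_n)$ of non-negative integers with $\sum_i\lambda_i=d$. For $\lambda\in\Lambda(n,d)$ put $$\Gamma^\lambda=\Gamma^{\lambda_1}\otimes\cdots\otimes\Gamma^{\lambda_n},\qquad \Lambda^\lambda=\Lambda^{\lambda_1}\otimes\cdots\otimes\Lambda^{\lambda_n}\qquad\text{in }\operatorname{Rep}\Gamma^d_k .$$ *Internal tensor product.* The tensor product of $k$-modules and of $k$-linear maps, the latter applied in each tensor factor, defines a bifunctor $-\otimes-\colon\Gamma^d\mathsf P_k\times\Gamma^d\mathsf P_k\to\Gamma^d\mathsf P_k$. For $X,Y\in\operatorname{Rep}\Gamma^d_k$ let $X\otimes_{\Gamma^d_k}Y\in\operatorname{Rep}\Gamma^d_k$ be their $k$-linear Day convolution along this bifunctor, $$(X\otimes_{\Gamma^d_k}Y)(U)=\int^{V,W}\operatorname{Hom}_{\Gamma^d\mathsf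 P_k}(V\otimes W,U)\otimes_k X(V)\otimes_k Y(W).$$ **Proposition.** For each $\lambda\in\Lambda(n,d)$ there is an isomorphism in $\operatorname{Rep}\Gamma^d_k$ $$\Lambda^\lambda\;\cong\;\Lambda^d\otimes_{\Gamma^d_k}\Gamma^\lambda .$$ -/

import Mathlib

universe u

namespace StrictPoly

open TensorProduct CategoryTheory

/-! ## Tensor powers and symmetric tensors -/

section SymmetricTensors

variable (k : Type u) [CommRing k] (d : ℕ)
variable {M N P Q : Type u} [AddCommGroup M] [Module k M] [AddCommGroup N] [Module k N]
  [AddCommGroup P] [Module k P] [AddCommGroup Q] [Module k Q]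

/-- The permutation `σ` of the factors of `M^{⊗d}`. -/
noncomputable def permT (M : Type u) [AddCommGroup M] [Module k M] (σ : Equiv.Perm (Fin d)) :
    (⨂[k]^d M) →ₗ[k] (⨂[k]^d M) :=
  (PiTensorProduct.reindex k (fun _ : Fin d => M) σ).toLinearMap

theorem permT_tprod (σ : Equiv.Perm (Fin d)) (v : Fin d → M) :
    permT k d M σ (PiTensorProduct.tprod k v) = PiTensorProduct.tprod k (fun i => v (σ.symm i)) :=
  PiTensorProduct.reindex_tprod _ _

/-- `Γ^d M`: the submodule of `M^{⊗d}` of all tensors invariant under the symmetric group. -/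
def Gamma (M : Type u) [AddCommGroup M] [Module k M] : Submodule k (⨂[k]^d M) where
  carrier := {t | ∀ σ : Equiv.Perm (Fin d), permT k d M σ t = t}
  add_mem' ha hb σ := by rw [map_add, ha σ, hb σ]
  zero_mem' σ := map_zero _
  smul_mem' c x hx σ := by rw [map_smul, hx σ]

noncomputable instance gammaAddCommGroup : AddCommGroup (Gamma k d M) :=
  Submodule.addCommGroup _

noncomputable instance gammaModule : Module k (Gamma k d M) :=
  Submodule.module _

theorem mem_Gamma {t : ⨂[k]^d M} :
    t ∈ Gamma k d M ↔ ∀ σ : Equiv.Perm (Fin d), permT k d M σ t = t := Iff.rfl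

/-- The bilinear map `M^{⊗d} × N^{⊗d} → P^{⊗d}` obtained by applying a bilinear map
`B : M × N → P` in each of the `d` factors. -/
noncomputable def bilT (B : M →ₗ[k] N →ₗ[k] P) : (⨂[k]^d M) →ₗ[k] (⨂[k]^d N) →ₗ[k] (⨂[k]^d P) :=
  PiTensorProduct.map₂ (fun _ => B)

theorem bilT_tprod (B : M →ₗ[k] N →ₗ[k] P) (v : Fin d → M) (w : Fin d → N) :
    bilT k d B (PiTensorProduct.tprod k v) (PiTensorProduct.tprod k w) =
      PiTensorProduct.tprod k (fun i => B (v i) (w i)) :=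
  PiTensorProduct.map₂_tprod_tprod _ _ _

variable {k d}

/-- Induction principle: a linear identity on a tensor power may be checked on pure tensors. -/
theorem tens_ind {p : (⨂[k]^d M) → Prop} (t : ⨂[k]^d M)
    (h : ∀ v : Fin d → M, p (PiTensorProduct.tprod k v))
    (hs : ∀ (c : k) x, p x → p (c • x)) (ha : ∀ x y, p x → p y → p (x + y)) : p t :=
  PiTensorProduct.induction_on t (fun c v => hs c _ (h v)) ha

theorem bilT_perm (B : M →ₗ[k] N →ₗ[k] P) (σ : Equiv.Perm (Fin d)) (x : ⨂[k]^d M)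
    (y : ⨂[k]^d N) :
    bilT k d B (permT k d M σ x) (permT k d N σ y) = permT k d P σ (bilT k d B x y) := by
  induction x using tens_ind with
  | hs c x h => simp only [map_smul, LinearMap.smul_apply, h]
  | ha x x' h h' => simp only [map_add, LinearMap.add_apply, h, h']
  | h v =>
    induction y using tens_ind with
    | hs c x h => simp only [map_smul, h]
    | ha x x' h h' => simp only [map_add, h, h']
    | h w => simp only [permT_tprod, bilT_tprod]

theorem bilT_assoc {R S : Type u} [AddCommGroup R] [Module k R] [AddCommGroup S] [Module k S]
    (A : M →ₗ[k] S →ₗ[k] Q) (B : N →ₗ[k] P →ₗ[k] S)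
    (C : R →ₗ[k] P →ₗ[k] Q) (D : M →ₗ[k] N →ₗ[k] R)
    (h : ∀ x y z, A x (B y z) = C (D x y) z) (x : ⨂[k]^d M) (y : ⨂[k]^d N) (z : ⨂[k]^d P) :
    bilT k d A x (bilT k d B y z) = bilT k d C (bilT k d D x y) z := by
  induction x using tens_ind with
  | hs c x h => simp only [map_smul, LinearMap.smul_apply, h]
  | ha x x' h h' => simp only [map_add, LinearMap.add_apply, h, h']
  | h v =>
    induction y using tens_ind with
    | hs c x h => simp only [map_smul, LinearMap.smul_apply, h]
    | ha x x' h h' => simp only [map_add, LinearMap.add_apply, h, h']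
    | h w =>
      induction z using tens_ind with
      | hs c x h => simp only [map_smul, h]
      | ha x x' h h' => simp only [map_add, h, h']
      | h w => simp only [bilT_tprod, h]

theorem bilT_const_left (B : M →ₗ[k] N →ₗ[k] N) (m : M) (h : ∀ x, B m x = x) (y : ⨂[k]^d N) :
    bilT k d B (PiTensorProduct.tprod k (fun _ => m)) y = y := by
  induction y using tens_ind with
  | hs c x h => simp only [map_smul, h]
  | ha x x' h h' => simp only [map_add, h, h']
  | h w => simp only [bilT_tprod, h]

theorem bilT_const_right (B : M →ₗ[k] N →ₗ[k] M) (n : N) (h : ∀ x, B x n = x) (y : ⨂[k]^d M) :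
    bilT k d B y (PiTensorProduct.tprod k (fun _ => n)) = y := by
  induction y using tens_ind with
  | hs c x h => simp only [map_smul, LinearMap.smul_apply, h]
  | ha x x' h h' => simp only [map_add, LinearMap.add_apply, h, h']
  | h w => simp only [bilT_tprod, h]

variable (k d)

/-- The restriction of `bilT` to symmetric tensors. -/
noncomputable def bilG (B : M →ₗ[k] N →ₗ[k] P) :
    Gamma k d M →ₗ[k] Gamma k d N →ₗ[k] Gamma k d P :=
  LinearMap.mk₂ k
    (fun x y => ⟨bilT k d B x.1 y.1, fun σ => by
      rw [← bilT_perm, x.2 σ, y.2 σ]⟩)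
    (fun x x' y => Subtype.ext (by simp))
    (fun c x y => Subtype.ext (by simp))
    (fun x y y' => Subtype.ext (by simp))
    (fun c x y => Subtype.ext (by simp))

@[simp] theorem bilG_coe (B : M →ₗ[k] N →ₗ[k] P) (x : Gamma k d M) (y : Gamma k d N) :
    (bilG k d B x y : ⨂[k]^d P) = bilT k d B x.1 y.1 := rfl

/-- The symmetric tensor `m ⊗ ⋯ ⊗ m`. -/
noncomputable def constG (m : M) : Gamma k d M :=
  ⟨PiTensorProduct.tprod k (fun _ => m), fun σ => permT_tprod k d σ _⟩

@[simp] theorem constG_coe (m : M) :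
    (constG k d m : ⨂[k]^d M) = PiTensorProduct.tprod k (fun _ => m) := rfl

end SymmetricTensors

/-! ## The category of divided powers and its representations -/

/-- The objects of `Γ^d P_k`: finitely generated projective `k`-modules. -/
structure GammaP (k : Type u) [CommRing k] (d : ℕ) where
  /-- the underlying type -/
  carrier : Type u
  [addCommGroup : AddCommGroup carrier]
  [module : Module k carrier]
  [finite : Module.Finite k carrier]
  [projective : Module.Projective k carrier]

namespace GammaP

variable {k : Type u} [CommRing k] {d : ℕ}

instance : CoeSort (GammaP k d) (Type u) := ⟨GammaP.carrier⟩

attribute [instance] addCommGroup module finite projective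

/-- The object of `Γ^e P_k` given by the same module. -/
abbrev deg (V : GammaP k d) (e : ℕ) : GammaP k e := ⟨V⟩

/-- `Hom(V, W) = Γ^d Hom_k(V, W)`. The composition is induced by the composition of `k`-linear
maps, applied in each tensor factor. -/
noncomputable instance : Category.{u} (GammaP k d) where
  Hom V W := Gamma k d (V →ₗ[k] W)
  id _ := constG k d LinearMap.id
  comp {U V W} f g := bilG k d (LinearMap.llcomp k U V W) g f
  id_comp f := Subtype.ext (bilT_const_right _ _ (fun x => LinearMap.comp_id x) f.1)
  comp_id f := Subtype.ext (bilT_const_left _ _ (fun x => LinearMap.id_comp x) f.1)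
  assoc f g h := Subtype.ext (bilT_assoc _ _ _ _ (fun _ _ _ => rfl) h.1 g.1 f.1)

noncomputable instance : Preadditive (GammaP k d) where
  homGroup _ _ := gammaAddCommGroup k d
  add_comp U V W f f' g := (bilG k d (LinearMap.llcomp k U V W) g).map_add f f'
  comp_add U V W f g g' := LinearMap.map_add₂ (bilG k d (LinearMap.llcomp k U V W)) g g' f

noncomputable instance : Linear k (GammaP k d) where
  homModule _ _ := gammaModule k d
  smul_comp U V W c f g := (bilG k d (LinearMap.llcomp k U V W) g).map_smul c f
  comp_smul U V W f c g := LinearMap.map_smul₂ (bilG k d (LinearMap.llcomp k U V W)) c g f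

end GammaP

/-- `Rep Γ^d_k`: the category of `k`-linear functors from `Γ^d P_k` to `k`-modules. -/
abbrev Rep (k : Type u) [CommRing k] (d : ℕ) :=
  ObjectProperty.FullSubcategory
    (fun F : GammaP k d ⥤ ModuleCat.{u} k => F.Additive ∧ F.Linear k)

namespace Rep

variable {k : Type u} [CommRing k] {d : ℕ}

/-- The module `X(V)`. -/
abbrev ev (X : Rep k d) (V : GammaP k d) : Type u := X.obj.obj V

/-- The `k`-linear map `Γ^d Hom(V, W) → Hom(X(V), X(W))`. -/
noncomputable def act (X : Rep k d) (V W : GammaP k d) :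
    Gamma k d (V →ₗ[k] W) →ₗ[k] X.ev V →ₗ[k] X.ev W where
  toFun f := (X.obj.map (X := V) (Y := W) f).hom
  map_add' f g := by
    have := X.property.1
    exact congrArg ModuleCat.Hom.hom (X.obj.map_add (f := (show V ⟶ W from f)) (g := g))
  map_smul' c f := by
    have := X.property.2
    exact congrArg ModuleCat.Hom.hom (X.obj.map_smul c (show V ⟶ W from f))

theorem act_id (X : Rep k d) (V : GammaP k d) :
    X.act V V (constG k d LinearMap.id) = LinearMap.id :=
  congrArg ModuleCat.Hom.hom (X.obj.map_id V)

theorem act_comp (X : Rep k d) (U V W : GammaP k d) (g : Gamma k d (V →ₗ[k] W))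
    (f : Gamma k d (U →ₗ[k] V)) :
    X.act U W (bilG k d (LinearMap.llcomp k U V W) g f) = X.act V W g ∘ₗ X.act U V f :=
  congrArg ModuleCat.Hom.hom
    (X.obj.map_comp (show U ⟶ V from f) (show V ⟶ W from g))

/-- A representation from modules `X(V)` and compatible `k`-linear maps
`Γ^d Hom(V, W) → Hom(X(V), X(W))`. -/
noncomputable def ofAct (E : GammaP k d → Type u) [∀ V, AddCommGroup (E V)] [∀ V, Module k (E V)]
    (a : ∀ V W : GammaP k d, Gamma k d (V →ₗ[k] W) →ₗ[k] E V →ₗ[k] E W)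
    (hid : ∀ V, a V V (constG k d LinearMap.id) = LinearMap.id)
    (hcomp : ∀ (U V W : GammaP k d) (g : Gamma k d (V →ₗ[k] W)) (f : Gamma k d (U →ₗ[k] V)),
      a U W (bilG k d (LinearMap.llcomp k U V W) g f) = a V W g ∘ₗ a U V f) : Rep k d where
  obj :=
    { obj := fun V => ModuleCat.of k (E V)
      map := fun {V W} f => ModuleCat.ofHom (a V W f)
      map_id := fun V => congrArg ModuleCat.ofHom (hid V)
      map_comp := fun {U V W} f g => congrArg ModuleCat.ofHom (hcomp U V W g f) }
  property :=
    ⟨⟨fun {V W f g} => congrArg ModuleCat.ofHom ((a V W).map_add f g)⟩,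
      ⟨fun {V W} f c => congrArg ModuleCat.ofHom ((a V W).map_smul c f)⟩⟩

end Rep

/-- The representation `V ↦ Γ^d V`. -/
noncomputable def divPow (k : Type u) [CommRing k] (d : ℕ) : Rep k d :=
  Rep.ofAct (fun V => Gamma k d V) (fun _ _ => bilG k d LinearMap.id)
    (fun _ => LinearMap.ext fun t => Subtype.ext (bilT_const_left _ _ (fun _ => rfl) t.1))
    (fun _ _ _ g f => LinearMap.ext fun t => Subtype.ext
      (bilT_assoc _ _ _ _ (fun _ _ _ => rfl) g.1 f.1 t.1).symm)

/-! ## Coordinates of tensors over a finitely generated projective module -/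

section Coordinates

variable {k : Type u} [CommRing k] {d n : ℕ}
variable {M : Type u} [AddCommGroup M] [Module k M]

/-- A finitely generated projective module has a finite dual basis. -/
theorem exists_dualBasis (k M : Type u) [CommRing k] [AddCommGroup M] [Module k M]
    [Module.Finite k M] [Module.Projective k M] :
    ∃ (n : ℕ) (e : Fin n → M) (φ : Fin n → M →ₗ[k] k), ∀ x, ∑ i, φ i x • e i = x := by
  obtain ⟨n, f, g, -, -, h⟩ := Module.Finite.exists_comp_eq_id_of_projective k M
  refine ⟨n, fun i => f (Pi.single i 1), fun i => LinearMap.proj i ∘ₗ g, fun x => ?_⟩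
  have h1 : g x = ∑ i, g x i • (Pi.single i 1 : Fin n → k) := by
    ext j; simp [Finset.sum_apply, Pi.single_apply]
  conv_rhs => rw [← LinearMap.id_apply (R := k) x, ← h, LinearMap.comp_apply, h1, map_sum]
  simp

/-- The coordinate functional `φ_{s 1} ⊗ ⋯ ⊗ φ_{s d}`. -/
noncomputable def coefT (φ : Fin n → M →ₗ[k] k) (s : Fin d → Fin n) : (⨂[k]^d M) →ₗ[k] k :=
  PiTensorProduct.lift
    ((MultilinearMap.mkPiAlgebra k (Fin d) k).compLinearMap (fun i => φ (s i)))

theorem coefT_tprod (φ : Fin n → M →ₗ[k] k) (s : Fin d → Fin n) (v : Fin d → M) :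
    coefT φ s (PiTensorProduct.tprod k v) = ∏ i, φ (s i) (v i) := by
  simp [coefT]

theorem coefT_perm (φ : Fin n → M →ₗ[k] k) (s : Fin d → Fin n) (σ : Equiv.Perm (Fin d)) :
    coefT φ s ∘ₗ permT k d M σ = coefT φ (s ∘ σ) := by
  refine LinearMap.ext fun t => ?_
  induction t using tens_ind with
  | hs c x h => simp only [map_smul, h]
  | ha x x' h h' => simp only [map_add, h, h']
  | h v =>
    rw [LinearMap.comp_apply, permT_tprod, coefT_tprod, coefT_tprod,
      ← Equiv.prod_comp σ (fun i => (φ (s i)) (v (σ.symm i)))]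
    simp

theorem coefT_expand (e : Fin n → M) (φ : Fin n → M →ₗ[k] k)
    (h : ∀ x, ∑ i, φ i x • e i = x) (t : ⨂[k]^d M) :
    ∑ s : Fin d → Fin n, coefT φ s t • PiTensorProduct.tprod k (fun i => e (s i)) = t := by
  induction t using tens_ind with
  | hs c x h => simp only [map_smul, smul_assoc, ← Finset.smul_sum, h]
  | ha x x' h h' => simp only [map_add, add_smul, Finset.sum_add_distrib, h, h']
  | h v =>
    conv_rhs => rw [show v = fun i => ∑ j, φ j (v i) • e j from funext fun i => (h (v i)).symm]
    rw [MultilinearMap.map_sum]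
    refine Finset.sum_congr rfl fun s _ => ?_
    rw [coefT_tprod, ← MultilinearMap.map_smul_univ]

/-- A tensor which is invariant under a transposition vanishes in the exterior power. -/
theorem wedge_eq_zero [Module.Finite k M] [Module.Projective k M] (t : ⨂[k]^d M)
    {i j : Fin d} (hij : i ≠ j) (ht : permT k d M (Equiv.swap i j) t = t) :
    PiTensorProduct.lift (exteriorPower.ιMulti k d (M := M)).toMultilinearMap t = 0 := by
  obtain ⟨n, e, φ, h⟩ := exists_dualBasis k M
  have hc (s : Fin d → Fin n) : coefT φ (s ∘ Equiv.swap i j) t = coefT φ s t := by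
    conv_rhs => rw [← ht, ← LinearMap.comp_apply, coefT_perm]
  rw [← coefT_expand e φ h t, map_sum]
  refine Finset.sum_involution (fun s _ => s ∘ Equiv.swap i j) ?_ ?_ ?_ ?_
  · intro s _
    rw [map_smul, map_smul, hc, PiTensorProduct.lift.tprod, PiTensorProduct.lift.tprod,
      ← smul_add]
    have := (exteriorPower.ιMulti k d (M := M)).map_swap (fun i => e (s i)) hij
    rw [show (exteriorPower.ιMulti k d (M := M)).toMultilinearMap
      (fun a => e ((s ∘ Equiv.swap i j) a)) =
      (exteriorPower.ιMulti k d (M := M)) ((fun i => e (s i)) ∘ Equiv.swap i j) from rfl, this]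
    simp
  · intro s _ hs heq
    apply hs
    rw [map_smul, PiTensorProduct.lift.tprod]
    have : s i = s j := by
      conv_lhs => rw [← heq]
      simp
    have h0 := (exteriorPower.ιMulti k d (M := M)).map_eq_zero_of_eq (fun i => e (s i))
      (congrArg e this) hij
    erw [h0]
    simp
  · intro s _; exact Finset.mem_univ _
  · intro s _
    ext a; simp

/-- A retraction of `M^{⊗d}` onto the symmetric tensors, which moreover fixes all elements
of `M^{⊗d} ⊗ N` that are invariant under permutations of the first `d` factors. -/
theorem exists_retraction (k : Type u) [CommRing k] (d : ℕ) (M : Type u) [AddCommGroup M]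
    [Module k M] [Module.Finite k M] [Module.Projective k M] :
    ∃ r : (⨂[k]^d M) →ₗ[k] Gamma k d M,
      r ∘ₗ (Gamma k d M).subtype = LinearMap.id ∧
      (∀ (N : Type u) [AddCommGroup N] [Module k N] (t : (⨂[k]^d M) ⊗[k] N),
        (∀ σ, (permT k d M σ).rTensor N t = t) →
          ((Gamma k d M).subtype ∘ₗ r).rTensor N t = t) ∧
      (∀ (N : Type u) [AddCommGroup N] [Module k N] (t : N ⊗[k] (⨂[k]^d M)),
        (∀ σ, (permT k d M σ).lTensor N t = t) →
          ((Gamma k d M).subtype ∘ₗ r).lTensor N t = t) := by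
  obtain ⟨n, e, φ, h⟩ := exists_dualBasis k M
  let E (s : Fin d → Fin n) : k →ₗ[k] (⨂[k]^d M) :=
    LinearMap.toSpanSingleton k _ (PiTensorProduct.tprod k (fun i => e (s i)))
  let ρ (s : Fin d → Fin n) : Fin d → Fin n := s ∘ Tuple.sort s
  have hρ (s : Fin d → Fin n) (σ : Equiv.Perm (Fin d)) : ρ (s ∘ σ) = ρ s :=
    Tuple.comp_perm_comp_sort_eq_comp_sort
  let p : (⨂[k]^d M) →ₗ[k] (⨂[k]^d M) := ∑ s, E s ∘ₗ coefT φ (ρ s)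
  have hid : ∑ s, E s ∘ₗ coefT φ s = (LinearMap.id : (⨂[k]^d M) →ₗ[k] (⨂[k]^d M)) := by
    refine LinearMap.ext fun t => ?_
    simpa [E] using coefT_expand e φ h t
  have hE (s : Fin d → Fin n) (σ : Equiv.Perm (Fin d)) :
      permT k d M σ ∘ₗ E s = E (s ∘ σ.symm) := by
    ext; simp [E, permT_tprod]
  have hp (t : ⨂[k]^d M) : p t ∈ Gamma k d M := by
    intro σ
    simp only [p, LinearMap.sum_apply, map_sum]
    rw [← Equiv.sum_comp (σ.arrowCongr (Equiv.refl (Fin n)))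
      (fun s => (E s ∘ₗ coefT φ (ρ s)) t)]
    refine Finset.sum_congr rfl fun s _ => ?_
    have : (σ.arrowCongr (Equiv.refl (Fin n))) s = s ∘ σ.symm := by ext; simp
    rw [this, hρ, ← hE]
    rfl
  have hR (N : Type u) [AddCommGroup N] [Module k N] (t : (⨂[k]^d M) ⊗[k] N)
      (ht : ∀ σ, (permT k d M σ).rTensor N t = t) : p.rTensor N t = t := by
    have : p.rTensor N t = (∑ s, E s ∘ₗ coefT φ s).rTensor N t := by
      change LinearMap.rTensorHom N p t = LinearMap.rTensorHom N (∑ s, E s ∘ₗ coefT φ s) t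
      simp only [p, map_sum, LinearMap.sum_apply, LinearMap.coe_rTensorHom]
      refine Finset.sum_congr rfl fun s _ => ?_
      rw [← coefT_perm, LinearMap.rTensor_comp_apply, LinearMap.rTensor_comp_apply, ht,
        LinearMap.rTensor_comp_apply]
    rw [this, hid, LinearMap.rTensor_id_apply]
  have hL (N : Type u) [AddCommGroup N] [Module k N] (t : N ⊗[k] (⨂[k]^d M))
      (ht : ∀ σ, (permT k d M σ).lTensor N t = t) : p.lTensor N t = t := by
    have : p.lTensor N t = (∑ s, E s ∘ₗ coefT φ s).lTensor N t := by
      change LinearMap.lTensorHom N p t = LinearMap.lTensorHom N (∑ s, E s ∘ₗ coefT φ s) t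
      simp only [p, map_sum, LinearMap.sum_apply, LinearMap.coe_lTensorHom]
      refine Finset.sum_congr rfl fun s _ => ?_
      rw [← coefT_perm, LinearMap.lTensor_comp_apply, LinearMap.lTensor_comp_apply, ht,
        LinearMap.lTensor_comp_apply]
    rw [this, hid, LinearMap.lTensor_id_apply]
  refine ⟨p.codRestrict _ hp, ?_, fun N _ _ => hR N, fun N _ _ => hL N⟩
  refine LinearMap.ext fun g => Subtype.ext ?_
  change p g.1 = g.1
  conv_rhs => rw [← LinearMap.id_apply (R := k) g.1, ← hid]
  simp only [p, LinearMap.sum_apply]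
  refine Finset.sum_congr rfl fun s _ => ?_
  rw [← coefT_perm, LinearMap.comp_apply, LinearMap.comp_apply, g.2, LinearMap.comp_apply]

end Coordinates

/-! ## Exterior powers -/

section Exterior

variable {k : Type u} [CommRing k] {d : ℕ}

/-- The canonical projection `V^{⊗d} → Λ^d V`. -/
noncomputable def wedge (k : Type u) [CommRing k] (d : ℕ) (V : Type u) [AddCommGroup V]
    [Module k V] : (⨂[k]^d V) →ₗ[k] ⋀[k]^d V :=
  PiTensorProduct.lift (exteriorPower.ιMulti k d (M := V)).toMultilinearMap

theorem wedge_tprod {V : Type u} [AddCommGroup V] [Module k V] (v : Fin d → V) :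
    wedge k d V (PiTensorProduct.tprod k v) = exteriorPower.ιMulti k d v :=
  PiTensorProduct.lift.tprod _

/-- The alternating map `(v_1, …, v_d) ↦ f (v_1 ⊗ ⋯ ⊗ v_d)` with values in `Λ^d W`, for
`f ∈ Γ^d Hom(V, W)`. -/
noncomputable def extAlt {V W : Type u} [AddCommGroup V] [Module k V] [AddCommGroup W]
    [Module k W] [Module.Finite k W] [Module.Projective k W] (f : Gamma k d (V →ₗ[k] W)) :
    V [⋀^Fin d]→ₗ[k] ⋀[k]^d W where
  toMultilinearMap := (wedge k d W ∘ₗ bilT k d LinearMap.id f.1).compMultilinearMap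
    (PiTensorProduct.tprod k)
  map_eq_zero_of_eq' v i j hv hij := by
    refine wedge_eq_zero _ hij ?_
    rw [← bilT_perm, f.2, permT_tprod]
    congr 2
    funext a
    simp only [Equiv.symm_swap]
    rcases eq_or_ne a i with rfl | hai
    · simp [hv]
    rcases eq_or_ne a j with rfl | haj
    · simp [hv]
    rw [Equiv.swap_apply_of_ne_of_ne hai haj]

/-- The action of `f ∈ Γ^d Hom(V, W)` on exterior powers: the map `Λ^d V → Λ^d W` induced by
`V^{⊗d} → W^{⊗d}`. -/
noncomputable def extAct (V W : GammaP k d) :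
    Gamma k d (V →ₗ[k] W) →ₗ[k] (⋀[k]^d V) →ₗ[k] ⋀[k]^d W where
  toFun f := exteriorPower.alternatingMapLinearEquiv (extAlt f)
  map_add' f g := by
    rw [← map_add]; congr 1; ext v; simp [extAlt]; rfl
  map_smul' c f := by
    rw [← map_smul]; congr 1; ext v; simp [extAlt]; rfl

theorem extAct_wedge (V W : GammaP k d) (f : Gamma k d (V →ₗ[k] W)) (t : ⨂[k]^d V.carrier) :
    extAct V W f (wedge k d V t) = wedge k d W (bilT k d LinearMap.id f.1 t) := by
  induction t using tens_ind with
  | hs c x h => simp only [map_smul, h]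
  | ha x x' h h' => simp only [map_add, h, h']
  | h v =>
    rw [wedge_tprod]
    exact exteriorPower.alternatingMapLinearEquiv_apply_ιMulti _ _

/-- The representation `V ↦ Λ^d V`. -/
noncomputable def extPow (k : Type u) [CommRing k] (d : ℕ) : Rep k d :=
  Rep.ofAct (fun V => ⋀[k]^d V) extAct
    (fun V => exteriorPower.linearMap_ext (AlternatingMap.ext fun v => by
      simp only [LinearMap.compAlternatingMap_apply, ← wedge_tprod, extAct_wedge]
      rw [constG_coe, bilT_const_left _ _ (fun _ => rfl), LinearMap.id_apply]))
    (fun U V W g f => exteriorPower.linearMap_ext (AlternatingMap.ext fun v => by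
      simp only [LinearMap.compAlternatingMap_apply, LinearMap.comp_apply, ← wedge_tprod,
        extAct_wedge]
      rw [bilG_coe, ← bilT_assoc LinearMap.id LinearMap.id LinearMap.id
        (LinearMap.llcomp k U V W) (fun _ _ _ => rfl)]))

end Exterior

/-! ## The external tensor product -/

section External

variable {k : Type u} [CommRing k] {a b d : ℕ}

/-- Concatenation of tensors `M^{⊗a} ⊗ M^{⊗b} ≅ M^{⊗d}` for `a + b = d`. -/
noncomputable def concatT (k : Type u) [CommRing k] (h : a + b = d) (M : Type u) [AddCommGroup M]
    [Module k M] : (⨂[k]^a M) ⊗[k] (⨂[k]^b M) ≃ₗ[k] (⨂[k]^d M) :=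
  TensorPower.mulEquiv.trans (TensorPower.cast k M h)

/-- The map `Γ^a M ⊗ Γ^b M → M^{⊗d}` induced by the inclusions into the tensor powers. -/
noncomputable def concatG (k : Type u) [CommRing k] (h : a + b = d) (M : Type u)
    [AddCommGroup M] [Module k M] : Gamma k a M ⊗[k] Gamma k b M →ₗ[k] (⨂[k]^d M) :=
  (concatT k h M).toLinearMap ∘ₗ TensorProduct.map (Gamma k a M).subtype (Gamma k b M).subtype

section

variable {M N P : Type u} [AddCommGroup M] [Module k M] [AddCommGroup N] [Module k N]
  [AddCommGroup P] [Module k P]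

theorem concatT_tprod (h : a + b = d) (v : Fin a → M) (w : Fin b → M) :
    concatT k h M (PiTensorProduct.tprod k v ⊗ₜ PiTensorProduct.tprod k w) =
      PiTensorProduct.tprod k (fun i => Fin.append v w (Fin.cast h.symm i)) := by
  subst h
  have := TensorPower.tprod_mul_tprod k v w
  rw [TensorPower.gMul_def] at this
  simp only [concatT, LinearEquiv.trans_apply, this, TensorPower.cast_tprod]
  rfl

theorem concatT_bil (h : a + b = d) (B : M →ₗ[k] N →ₗ[k] P) (x : ⨂[k]^a M) (x' : ⨂[k]^b M)
    (y : ⨂[k]^a N) (y' : ⨂[k]^b N) :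
    bilT k d B (concatT k h M (x ⊗ₜ x')) (concatT k h N (y ⊗ₜ y')) =
      concatT k h P (bilT k a B x y ⊗ₜ bilT k b B x' y') := by
  induction x using tens_ind with
  | hs c x h => simp only [map_smul, LinearMap.smul_apply, ← TensorProduct.smul_tmul', h]
  | ha x x' h h' => simp only [map_add, LinearMap.add_apply, TensorProduct.add_tmul, h, h']
  | h v =>
    induction x' using tens_ind with
    | hs c x h => simp only [map_smul, LinearMap.smul_apply, TensorProduct.tmul_smul, h]
    | ha x x' h h' => simp only [map_add, LinearMap.add_apply, TensorProduct.tmul_add, h, h']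
    | h v' =>
      induction y using tens_ind with
      | hs c x h => simp only [map_smul, ← TensorProduct.smul_tmul', h]
      | ha x x' h h' => simp only [map_add, TensorProduct.add_tmul, h, h']
      | h w =>
        induction y' using tens_ind with
        | hs c x h => simp only [map_smul, TensorProduct.tmul_smul, h]
        | ha x x' h h' => simp only [map_add, TensorProduct.tmul_add, h, h']
        | h w' =>
          simp only [concatT_tprod, bilT_tprod]
          congr 1
          funext i
          obtain ⟨j, rfl⟩ : ∃ j : Fin (a + b), i = Fin.cast h j := ⟨Fin.cast h.symm i, by simp⟩
          refine Fin.addCases (fun j => ?_) (fun j => ?_) j <;> simp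

theorem concatG_bil (h : a + b = d) (B : M →ₗ[k] N →ₗ[k] P)
    (x : Gamma k a M ⊗[k] Gamma k b M) (y : Gamma k a N ⊗[k] Gamma k b N) :
    bilT k d B (concatG k h M x) (concatG k h N y) =
      concatG k h P (TensorProduct.map₂ (bilG k a B) (bilG k b B) x y) := by
  induction x using TensorProduct.induction_on with
  | zero => simp
  | add x x' h h' => simp only [map_add, LinearMap.add_apply, h, h']
  | tmul x x' =>
    induction y using TensorProduct.induction_on with
    | zero => simp
    | add x x' h h' => simp only [map_add, h, h']
    | tmul y y' => exact concatT_bil h B x.1 x'.1 y.1 y'.1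

/-- Permuting the first `a` tensor factors. -/
theorem concatT_permL (h : a + b = d) (σ : Equiv.Perm (Fin a)) : ∃ τ : Equiv.Perm (Fin d),
    ∀ t, permT k d M τ (concatT k h M t) = concatT k h M ((permT k a M σ).rTensor _ t) := by
  subst h
  refine ⟨finSumFinEquiv.permCongr (Equiv.sumCongr σ (Equiv.refl _)), fun t => ?_⟩
  rw [← LinearEquiv.coe_coe, ← LinearMap.comp_apply, ← LinearMap.comp_apply]
  refine LinearMap.congr_fun (TensorProduct.ext' fun x y => ?_) t
  simp only [LinearMap.comp_apply, LinearEquiv.coe_coe, LinearMap.rTensor_tmul]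
  induction x using tens_ind with
  | hs c x h => simp only [map_smul, ← TensorProduct.smul_tmul', h]
  | ha x x' h h' => simp only [map_add, TensorProduct.add_tmul, h, h']
  | h v =>
    induction y using tens_ind with
    | hs c x h => simp only [map_smul, TensorProduct.tmul_smul, h]
    | ha x x' h h' => simp only [map_add, TensorProduct.tmul_add, h, h']
    | h w =>
      simp only [concatT_tprod, permT_tprod]
      congr 1
      funext i
      refine Fin.addCases (fun j => ?_) (fun j => ?_) i <;> simp [Equiv.permCongr_def]

/-- Permuting the last `b` tensor factors. -/
theorem concatT_permR (h : a + b = d) (σ : Equiv.Perm (Fin b)) : ∃ τ : Equiv.Perm (Fin d),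
    ∀ t, permT k d M τ (concatT k h M t) = concatT k h M ((permT k b M σ).lTensor _ t) := by
  subst h
  refine ⟨finSumFinEquiv.permCongr (Equiv.sumCongr (Equiv.refl _) σ), fun t => ?_⟩
  rw [← LinearEquiv.coe_coe, ← LinearMap.comp_apply, ← LinearMap.comp_apply]
  refine LinearMap.congr_fun (TensorProduct.ext' fun x y => ?_) t
  simp only [LinearMap.comp_apply, LinearEquiv.coe_coe, LinearMap.lTensor_tmul]
  induction x using tens_ind with
  | hs c x h => simp only [map_smul, ← TensorProduct.smul_tmul', h]
  | ha x x' h h' => simp only [map_add, TensorProduct.add_tmul, h, h']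
  | h v =>
    induction y using tens_ind with
    | hs c x h => simp only [map_smul, TensorProduct.tmul_smul, h]
    | ha x x' h h' => simp only [map_add, TensorProduct.tmul_add, h, h']
    | h w =>
      simp only [concatT_tprod, permT_tprod]
      congr 1
      funext i
      refine Fin.addCases (fun j => ?_) (fun j => ?_) i <;> simp [Equiv.permCongr_def]

variable [Module.Finite k M] [Module.Projective k M]

theorem concatG_injective (h : a + b = d) : Function.Injective (concatG k h M) := by
  obtain ⟨r, hr, -, -⟩ := exists_retraction k a M
  obtain ⟨s, hs, -, -⟩ := exists_retraction k b M
  refine (concatT k h M).injective.comp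
    (LinearMap.injective_of_comp_eq_id _ (TensorProduct.map r s) ?_)
  rw [← TensorProduct.map_comp, hr, hs, TensorProduct.map_id]

theorem mem_range_concatG (h : a + b = d) (t : Gamma k d M) :
    (t : ⨂[k]^d M) ∈ LinearMap.range (concatG k h M) := by
  obtain ⟨r, -, hr, -⟩ := exists_retraction k a M
  obtain ⟨s, -, -, hs⟩ := exists_retraction k b M
  set t' := (concatT k h M).symm t.1 with ht'
  have h1 : ((Gamma k a M).subtype ∘ₗ r).rTensor _ t' = t' := by
    refine hr _ _ fun σ => ?_
    obtain ⟨τ, hτ⟩ := concatT_permL (k := k) (M := M) h σ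
    apply (concatT k h M).injective
    rw [← hτ, ht', LinearEquiv.apply_symm_apply, t.2]
  have h2 : ((Gamma k b M).subtype ∘ₗ s).lTensor _ t' = t' := by
    refine hs _ _ fun σ => ?_
    obtain ⟨τ, hτ⟩ := concatT_permR (k := k) (M := M) h σ
    apply (concatT k h M).injective
    rw [← hτ, ht', LinearEquiv.apply_symm_apply, t.2]
  refine ⟨TensorProduct.map r s t', ?_⟩
  have h3 : TensorProduct.map (Gamma k a M).subtype (Gamma k b M).subtype
      (TensorProduct.map r s t') = t' := by
    rw [← LinearMap.comp_apply, ← TensorProduct.map_comp, ← LinearMap.rTensor_comp_lTensor,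
      LinearMap.comp_apply, h2, h1]
  change concatT k h M (TensorProduct.map (Gamma k a M).subtype (Gamma k b M).subtype
      (TensorProduct.map r s t')) = t.1
  rw [h3, ht', LinearEquiv.apply_symm_apply]

variable (k M)

/-- The map `Γ^d M → Γ^a M ⊗ Γ^b M`: the inclusion of the `𝔖_d`-invariants of `M^{⊗d}` into the
`𝔖_a × 𝔖_b`-invariants, the latter being identified with `Γ^a M ⊗ Γ^b M`. -/
noncomputable def comulG (h : a + b = d) : Gamma k d M →ₗ[k] Gamma k a M ⊗[k] Gamma k b M :=
  (LinearEquiv.ofInjective (concatG k h M) (concatG_injective h)).symm.toLinearMap ∘ₗ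
    (Gamma k d M).subtype.codRestrict _ (mem_range_concatG h)

variable {k M}

theorem concatG_comulG (h : a + b = d) (t : Gamma k d M) :
    concatG k h M (comulG k M h t) = t.1 :=
  congrArg Subtype.val ((LinearEquiv.ofInjective (concatG k h M)
    (concatG_injective h)).apply_symm_apply ⟨t.1, mem_range_concatG h t⟩)

theorem comulG_const (h : a + b = d) (m : M) :
    comulG k M h (constG k d m) = constG k a m ⊗ₜ constG k b m := by
  apply concatG_injective h
  rw [concatG_comulG]
  simp only [concatG, LinearMap.comp_apply, LinearEquiv.coe_coe, TensorProduct.map_tmul, Submodule.subtype_apply, constG_coe, concatT_tprod]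
  congr 1
  funext i
  obtain ⟨j, rfl⟩ : ∃ j : Fin (a + b), i = Fin.cast h j := ⟨Fin.cast h.symm i, by simp⟩
  refine Fin.addCases (fun j => ?_) (fun j => ?_) j <;> simp

theorem comulG_bil [Module.Finite k N] [Module.Projective k N] [Module.Finite k P]
    [Module.Projective k P] (h : a + b = d) (B : M →ₗ[k] N →ₗ[k] P) (x : Gamma k d M)
    (y : Gamma k d N) :
    comulG k P h (bilG k d B x y) =
      TensorProduct.map₂ (bilG k a B) (bilG k b B) (comulG k M h x) (comulG k N h y) := by
  apply concatG_injective h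
  rw [concatG_comulG, ← concatG_bil, concatG_comulG, concatG_comulG]
  rfl

end

instance homFinite {V W : Type u} [AddCommGroup V] [Module k V] [AddCommGroup W] [Module k W]
    [Module.Finite k V] [Module.Projective k V] [Module.Finite k W] [Module.Projective k W] :
    Module.Finite k (V →ₗ[k] W) := by
  obtain ⟨n, f, g, -, -, h⟩ := Module.Finite.exists_comp_eq_id_of_projective k V
  obtain ⟨m, f', g', -, -, h'⟩ := Module.Finite.exists_comp_eq_id_of_projective k W
  refine Module.Finite.of_surjective
    (LinearMap.llcomp k _ _ _ f' ∘ₗ LinearMap.lcomp k (Fin m → k) g) fun x =>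
      ⟨g' ∘ₗ x ∘ₗ f, ?_⟩
  ext v
  have h1 := LinearMap.congr_fun h v
  have h2 := LinearMap.congr_fun h' (x v)
  simp only [LinearMap.comp_apply, LinearMap.id_apply] at h1 h2
  simp [h1, h2]

instance homProjective {V W : Type u} [AddCommGroup V] [Module k V] [AddCommGroup W]
    [Module k W] [Module.Finite k V] [Module.Projective k V] [Module.Finite k W]
    [Module.Projective k W] : Module.Projective k (V →ₗ[k] W) := by
  obtain ⟨n, f, g, -, -, h⟩ := Module.Finite.exists_comp_eq_id_of_projective k V
  obtain ⟨m, f', g', -, -, h'⟩ := Module.Finite.exists_comp_eq_id_of_projective k W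
  refine Module.Projective.of_split
    (LinearMap.llcomp k _ _ _ g' ∘ₗ LinearMap.lcomp k W f)
    (LinearMap.llcomp k _ _ _ f' ∘ₗ LinearMap.lcomp k (Fin m → k) g) ?_
  ext x v
  have h1 := LinearMap.congr_fun h v
  have h2 := LinearMap.congr_fun h' (x v)
  simp only [LinearMap.comp_apply, LinearMap.id_apply] at h1 h2
  simp [h1, h2]

/-- The external tensor product `(X ⊗ Y)(V) = X(V) ⊗ Y(V)` of representations of degrees `a` and
`b`; a morphism `f ∈ Γ^d Hom(V, W)`, `d = a + b`, acts via `Γ^d → Γ^a ⊗ Γ^b`. -/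
noncomputable def extTensor (h : a + b = d) (X : Rep k a) (Y : Rep k b) : Rep k d :=
  Rep.ofAct (fun V => X.ev (V.deg _) ⊗[k] Y.ev (V.deg _))
    (fun V W => TensorProduct.map₂ (X.act (V.deg _) (W.deg _)) (Y.act (V.deg _) (W.deg _)) ∘ₗ comulG k (V →ₗ[k] W) h)
    (fun V => by
      rw [LinearMap.comp_apply, comulG_const, TensorProduct.map₂_apply_tmul]
      rw [X.act_id (V.deg _), Y.act_id (V.deg _), TensorProduct.map_id])
    (fun U V W g f => by
      rw [LinearMap.comp_apply, LinearMap.comp_apply, LinearMap.comp_apply, comulG_bil]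
      generalize comulG k (V →ₗ[k] W) h g = g'
      generalize comulG k (U →ₗ[k] V) h f = f'
      induction g' using TensorProduct.induction_on with
      | zero => simp
      | add x x' h h' => simp only [map_add, LinearMap.add_apply, h, h', LinearMap.add_comp]
      | tmul x x' =>
        induction f' using TensorProduct.induction_on with
        | zero => simp
        | add x x' h h' => simp only [map_add, h, h', LinearMap.comp_add]
        | tmul y y' =>
          simp only [TensorProduct.map₂_apply_tmul, TensorProduct.map_tmul]
          rw [X.act_comp (U.deg _) (V.deg _) (W.deg _), Y.act_comp (U.deg _) (V.deg _) (W.deg _), TensorProduct.map_comp])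

/-- For a family `E = (E^e)_{e ≥ 0}` with `E^e ∈ Rep Γ^e_k` and a sequence
`lam = (lam_1, …, lam_n)` of non-negative integers with sum `d`, the external tensor product
`E^{lam_1} ⊗ (E^{lam_2} ⊗ (⋯ ⊗ E^{lam_n}))`. (For `n = 1` one has `lam_1 = d`; for `n = 0` one has
`d = 0` and, for `E = Γ` and `E = Λ`, the unit `E^0 = k`.) -/
noncomputable def tensorSeq (E : ∀ e, Rep k e) :
    ∀ (n d : ℕ) (lam : Fin n → ℕ), ∑ i, lam i = d → Rep k d
  | 0, d, _, _ => E d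
  | 1, d, _, _ => E d
  | n + 2, d, lam, h =>
    extTensor (a := lam 0) (b := ∑ i : Fin (n + 1), lam i.succ) (d := d)
      ((Fin.sum_univ_succ lam).symm.trans h) (E (lam 0))
      (tensorSeq E (n + 1) _ (fun i => lam i.succ) rfl)

end External

/-! ## The internal tensor product -/

section Internal

variable {k : Type u} [CommRing k] {d : ℕ}

/-- The tensor product of objects of `Γ^d P_k`. -/
abbrev GammaP.tensor (V W : GammaP k d) : GammaP k d := ⟨V ⊗[k] W⟩

/-- The tensor product of morphisms of `Γ^d P_k`: the map
`Γ^d Hom(V, V') × Γ^d Hom(W, W') → Γ^d Hom(V ⊗ W, V' ⊗ W')` given by the tensor product of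
`k`-linear maps, applied in each tensor factor. -/
noncomputable def GammaP.tensorHom {V V' W W' : GammaP k d} (α : V ⟶ V') (β : W ⟶ W') :
    V.tensor W ⟶ V'.tensor W' :=
  bilG k d (TensorProduct.mapBilinear (RingHom.id k) V W V' W') α β

/-- A small set of finitely generated projective modules containing a representative of every
isomorphism class: the projective ones among the quotients of the modules `k^n`. -/
abbrev SmallP (k : Type u) [CommRing k] : Type u :=
  {x : FGModuleRepr k // Module.Projective k x.repr}

/-- The object of `Γ^d P_k` given by a representative. -/
abbrev SmallP.toP (x : SmallP k) (d : ℕ) : GammaP k d :=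
  { carrier := x.1.repr, projective := x.2 }

theorem SmallP.exists_equiv (V : GammaP k d) : ∃ x : SmallP k, Nonempty (x.toP d ≃ₗ[k] V) :=
  ⟨⟨FGModuleRepr.ofFinite k V, Module.Projective.of_equiv (FGModuleRepr.ofFiniteEquiv k V).symm⟩,
    ⟨FGModuleRepr.ofFiniteEquiv k V⟩⟩

variable (X Y : Rep k d)

/-- The summand `Hom(V ⊗ W, U) ⊗ (X(V) ⊗ Y(W))`, the first factor denoting the morphisms in
`Γ^d P_k`. -/
abbrev DayFibre (U : GammaP k d) (p : SmallP k × SmallP k) : Type u :=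
  ((p.1.toP d).tensor (p.2.toP d) ⟶ U) ⊗[k] (X.ev (p.1.toP d) ⊗[k] Y.ev (p.2.toP d))

/-- `⨁_{V, W} Hom(V ⊗ W, U) ⊗ (X(V) ⊗ Y(W))`. -/
abbrev DaySum (U : GammaP k d) : Type u :=
  DirectSum (SmallP k × SmallP k) (DayFibre X Y U)

open Classical in
/-- The element `f ⊗ (x ⊗ y)` of the summand with index `(V, W)`. -/
noncomputable def dayOf (U : GammaP k d) (V W : SmallP k) (f : (V.toP d).tensor (W.toP d) ⟶ U)
    (x : X.ev (V.toP d)) (y : Y.ev (W.toP d)) : DaySum X Y U :=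
  DirectSum.lof k (SmallP k × SmallP k) (DayFibre X Y U) (V, W) (f ⊗ₜ[k] (x ⊗ₜ[k] y))

/-- The relations of the coend:
`f ∘ (α ⊗ β) ⊗ (x ⊗ y) = f ⊗ (X(α) x ⊗ Y(β) y)` for `α : V → V'` and `β : W → W'`. -/
noncomputable def dayRel (U : GammaP k d) : Submodule k (DaySum X Y U) :=
  Submodule.span k {z | ∃ (V V' W W' : SmallP k)
    (α : V.toP d ⟶ V'.toP d) (β : W.toP d ⟶ W'.toP d)
    (f : (V'.toP d).tensor (W'.toP d) ⟶ U) (x : X.ev (V.toP d)) (y : Y.ev (W.toP d)),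
    z = dayOf X Y U V W (GammaP.tensorHom α β ≫ f) x y -
      dayOf X Y U V' W' f (X.obj.map α x) (Y.obj.map β y)}

/-- The map on direct sums induced by `g : U ⟶ U'`. -/
noncomputable def daySumMap {U U' : GammaP k d} (g : U ⟶ U') :
    DaySum X Y U →ₗ[k] DaySum X Y U' :=
  DirectSum.lmap fun _ => (Linear.rightComp k _ g).rTensor _

theorem daySumMap_of {U U' : GammaP k d} (g : U ⟶ U') (V W : SmallP k)
    (f : (V.toP d).tensor (W.toP d) ⟶ U) (x : X.ev (V.toP d)) (y : Y.ev (W.toP d)) :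
    daySumMap X Y g (dayOf X Y U V W f x y) = dayOf X Y U' V W (f ≫ g) x y := by
  classical
  simp only [daySumMap, dayOf, DirectSum.lmap_lof, LinearMap.rTensor_tmul, Linear.rightComp_apply]

/-- Linear maps out of `DaySum` are determined by their values on the elements `dayOf`. -/
theorem daySum_ext {U : GammaP k d} {N : Type u} [AddCommGroup N] [Module k N]
    {F G : DaySum X Y U →ₗ[k] N}
    (h : ∀ V W f x y, F (dayOf X Y U V W f x y) = G (dayOf X Y U V W f x y)) : F = G := by
  classical
  refine DirectSum.linearMap_ext k fun p => TensorProduct.ext' fun f z => ?_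
  induction z using TensorProduct.induction_on with
  | zero => simp
  | add x y hx hy => rw [TensorProduct.tmul_add, map_add, map_add, hx, hy]
  | tmul x y => exact h p.1 p.2 f x y

theorem dayRel_le {U U' : GammaP k d} (g : U ⟶ U') :
    dayRel X Y U ≤ (dayRel X Y U').comap (daySumMap X Y g) := by
  refine Submodule.span_le.mpr ?_
  rintro _ ⟨V, V', W, W', α, β, f, x, y, rfl⟩
  refine Submodule.subset_span ⟨V, V', W, W', α, β, f ≫ g, x, y, ?_⟩
  rw [map_sub, daySumMap_of, daySumMap_of, Category.assoc]

/-- The value of the coend at `U`. -/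
abbrev DayObj (U : GammaP k d) : Type u := DaySum X Y U ⧸ dayRel X Y U

/-- The action of morphisms on the coends, by composition. -/
noncomputable def dayAct (U U' : GammaP k d) : (U ⟶ U') →ₗ[k] DayObj X Y U →ₗ[k] DayObj X Y U' where
  toFun g := Submodule.mapQ _ _ (daySumMap X Y g) (dayRel_le X Y g)
  map_add' g g' := by
    refine Submodule.linearMap_qext _ (daySum_ext X Y fun V W f x y => ?_)
    simp only [LinearMap.comp_apply, LinearMap.add_apply, Submodule.mkQ_apply,
      Submodule.mapQ_apply, daySumMap_of, ← Submodule.Quotient.mk_add]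
    simp [dayOf, TensorProduct.add_tmul]
  map_smul' c g := by
    refine Submodule.linearMap_qext _ (daySum_ext X Y fun V W f x y => ?_)
    simp only [LinearMap.comp_apply, LinearMap.smul_apply, Submodule.mkQ_apply,
      Submodule.mapQ_apply, daySumMap_of, ← Submodule.Quotient.mk_smul, RingHom.id_apply]
    simp [dayOf, ← TensorProduct.smul_tmul']

theorem dayAct_mk {U U' : GammaP k d} (g : U ⟶ U') (V W : SmallP k)
    (f : (V.toP d).tensor (W.toP d) ⟶ U) (x : X.ev (V.toP d)) (y : Y.ev (W.toP d)) :
    dayAct X Y U U' g ((dayRel X Y U).mkQ (dayOf X Y U V W f x y)) =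
      (dayRel X Y U').mkQ (dayOf X Y U' V W (f ≫ g) x y) := by
  simp only [dayAct, LinearMap.coe_mk, AddHom.coe_mk, Submodule.mkQ_apply, Submodule.mapQ_apply,
    daySumMap_of]

theorem dayAct_id (U : GammaP k d) : dayAct X Y U U (𝟙 U) = LinearMap.id := by
  refine Submodule.linearMap_qext _ (daySum_ext X Y fun V W f x y => ?_)
  rw [LinearMap.comp_apply, dayAct_mk, Category.comp_id]
  rfl

theorem dayAct_comp (U U' U'' : GammaP k d) (f : U ⟶ U') (g : U' ⟶ U'') :
    dayAct X Y U U'' (f ≫ g) = dayAct X Y U' U'' g ∘ₗ dayAct X Y U U' f := by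
  refine Submodule.linearMap_qext _ (daySum_ext X Y fun V W h x y => ?_)
  rw [LinearMap.comp_apply, LinearMap.comp_apply, LinearMap.comp_apply, dayAct_mk, dayAct_mk,
    dayAct_mk, Category.assoc]

/-- The internal tensor product of `X, Y ∈ Rep Γ^d_k`: the `k`-linear Day convolution along the
tensor product of `Γ^d P_k`, that is, the coend
`(X ⊗ Y)(U) = ∫^{V, W} Hom(V ⊗ W, U) ⊗ X(V) ⊗ Y(W)`,
where `V` and `W` run through representatives of the isomorphism classes of objects. -/
noncomputable def internalTensor : Rep k d :=
  Rep.ofAct (DayObj X Y) (dayAct X Y) (dayAct_id X Y)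
    (fun U U' U'' g f => dayAct_comp X Y U U' U'' f g)

end Internal

end StrictPoly

/-! Suppose first that `G = Γ^d Hom(W₀, -)` is representable. The adjunction `Hom(V ⊗ W₀, U) ≅
Hom(V, Hom(W₀, U))` passes to `Γ^d P_k`, and the co-Yoneda lemma collapses the coend to `(Λ^d ⊗
G)(U) ≅ Λ^d Hom(W₀, U)`. For `W₀ = k^n`, the exponential properties split `Γ^d(W^n)` and `Λ^d(U^n)`
into sums of `Γ^μ(W)` and of `Λ^μ(U)` over all weights `μ`; the proposition compares the summands of
weight `λ`.

The proof isolates one weight without writing down the whole decomposition. `WedgeDatum` records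
what is needed: the element `gen = w₁^{⊗λ₁} ⊗ ⋯ ⊗ w_n^{⊗λ_n}` of `Γ^λ(W)`; a section `lift` of the
Yoneda map `f ↦ Γ^λ(f)(gen)`, which exhibits `Γ^λ` as a summand of a representable; the map
`wedgeMap` embedding `Λ^λ(U)` into `Λ^d(U^n)`; and a natural pairing of `Λ^d(V)` and `Γ^λ(W)` into
`Λ^λ(V ⊗ W)`, which induces `fromDay` from the coend to `Λ^λ`. The inverse sends `u` to the class of
`ev ⊗ wedgeMap u ⊗ gen`, where `ev : Hom(W₀, U) ⊗ W₀ → U`. One composite is the identity by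
`act_pair_gen`, the other by `lift_gen` and `wedgeMap_act_pair`.

The datum is built by induction on `n`, adding one factor at a time. Two compatibilities carry this:
a symmetric tensor acts on a shuffle product through its comultiplication (`bilG_shuffle`), and a
shuffle product acts on an exterior power by comultiplying, acting on the factors and multiplying
back (`extAct_shuffle`). In addition, comultiplication after multiplication is a sum over cosets of
the Young subgroup, of which only the trivial one survives a map on the first block killing the
second factor (`map_mapG_comulG_shuffle`, `map_extComul_extMul`). -/

namespace StrictPoly

open TensorProduct CategoryTheory

/-! ### Two blocks of tensor factors: products and coproducts on symmetric and exterior powers -/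

section Blocks

variable {k : Type u} [CommRing k] {a b d : ℕ}
variable {M N P : Type u} [AddCommGroup M] [Module k M] [AddCommGroup N] [Module k N]
  [AddCommGroup P] [Module k P]

theorem permT_mul (σ τ : Equiv.Perm (Fin d)) (t : ⨂[k]^d M) :
    permT k d M (σ * τ) t = permT k d M σ (permT k d M τ t) := by
  induction t using tens_ind with
  | hs c x h => simp only [map_smul, h]
  | ha x x' h h' => simp only [map_add, h, h']
  | h v => simp only [permT_tprod]; rfl

theorem wedge_permT (σ : Equiv.Perm (Fin d)) (t : ⨂[k]^d M) :
    wedge k d M (permT k d M σ t) = Equiv.Perm.sign σ • wedge k d M t := by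
  induction t using tens_ind with
  | hs c x h => rw [map_smul, map_smul, map_smul, h, smul_comm]
  | ha x x' h h' => rw [map_add, map_add, map_add, h, h', smul_add]
  | h v =>
    rw [permT_tprod, wedge_tprod, wedge_tprod, ← Equiv.Perm.sign_symm, ← AlternatingMap.map_perm]
    rfl

theorem wedge_surjective : Function.Surjective (wedge k d M) := by
  rw [← LinearMap.range_eq_top, ← top_le_iff, ← exteriorPower.ιMulti_span k d M,
    Submodule.span_le]
  rintro _ ⟨v, rfl⟩
  exact ⟨_, wedge_tprod v⟩

/-- The decomposition of `d = a + b` indices into a first and a second block. -/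
def blockEquiv (h : a + b = d) : Fin a ⊕ Fin b ≃ Fin d := finSumFinEquiv.trans (finCongr h)

/-- The permutation of tensor factors, the factors being indexed by `Fin a ⊕ Fin b`. -/
noncomputable def blockPerm (k : Type u) [CommRing k] (h : a + b = d) (M : Type u)
    [AddCommGroup M] [Module k M] (σ : Equiv.Perm (Fin a ⊕ Fin b)) :
    (⨂[k]^d M) →ₗ[k] (⨂[k]^d M) :=
  permT k d M ((blockEquiv h).permCongr σ)

theorem blockPerm_mul (h : a + b = d) (σ τ : Equiv.Perm (Fin a ⊕ Fin b)) (t : ⨂[k]^d M) :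
    blockPerm k h M (σ * τ) t = blockPerm k h M σ (blockPerm k h M τ t) := by
  rw [blockPerm, blockPerm, blockPerm, ← permT_mul]
  congr 2
  exact ((blockEquiv h).permCongrHom).map_mul σ τ

theorem blockPerm_one (h : a + b = d) (t : ⨂[k]^d M) : blockPerm k h M 1 t = t := by
  induction t using tens_ind with
  | hs c x h => simp only [map_smul, h]
  | ha x x' h h' => simp only [map_add, h, h']
  | h v =>
    rw [blockPerm, permT_tprod]
    congr 1
    funext i
    exact congrArg v ((blockEquiv h).apply_symm_apply i)

theorem blockPerm_tprod (h : a + b = d) (σ : Equiv.Perm (Fin a ⊕ Fin b))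
    (x : Fin a ⊕ Fin b → M) :
    blockPerm k h M σ (PiTensorProduct.tprod k (x ∘ (blockEquiv h).symm)) =
      PiTensorProduct.tprod k ((x ∘ σ.symm) ∘ (blockEquiv h).symm) := by
  rw [blockPerm, permT_tprod]
  congr 1
  funext i
  simp [Equiv.permCongr_def]

theorem bilT_blockPerm (h : a + b = d) (B : M →ₗ[k] N →ₗ[k] P)
    (σ : Equiv.Perm (Fin a ⊕ Fin b)) (x : ⨂[k]^d M) (y : ⨂[k]^d N) :
    bilT k d B (blockPerm k h M σ x) (blockPerm k h N σ y) =
      blockPerm k h P σ (bilT k d B x y) :=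
  bilT_perm B _ x y

theorem wedge_blockPerm (h : a + b = d) (σ : Equiv.Perm (Fin a ⊕ Fin b)) (t : ⨂[k]^d M) :
    wedge k d M (blockPerm k h M σ t) = Equiv.Perm.sign σ • wedge k d M t := by
  rw [blockPerm, wedge_permT, Equiv.Perm.sign_permCongr]

theorem concatT_tprod_elim (h : a + b = d) (x : Fin a ⊕ Fin b → M) :
    concatT k h M (PiTensorProduct.tprod k (x ∘ Sum.inl) ⊗ₜ PiTensorProduct.tprod k (x ∘ Sum.inr))
      = PiTensorProduct.tprod k (x ∘ (blockEquiv h).symm) := by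
  subst h
  rw [concatT_tprod]
  congr 1
  funext i
  refine Fin.addCases (fun j => ?_) (fun j => ?_) i <;> simp [blockEquiv]

theorem concatT_symm_tprod (h : a + b = d) (x : Fin a ⊕ Fin b → M) :
    (concatT k h M).symm (PiTensorProduct.tprod k (x ∘ (blockEquiv h).symm)) =
      PiTensorProduct.tprod k (x ∘ Sum.inl) ⊗ₜ PiTensorProduct.tprod k (x ∘ Sum.inr) := by
  rw [LinearEquiv.symm_apply_eq, concatT_tprod_elim]

/-- Linear maps out of a tensor power agree if they agree on pure tensors indexed by blocks. -/
theorem block_ext (h : a + b = d) {f g : (⨂[k]^d M) →ₗ[k] N}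
    (hfg : ∀ x : Fin a ⊕ Fin b → M, f (PiTensorProduct.tprod k (x ∘ (blockEquiv h).symm)) =
      g (PiTensorProduct.tprod k (x ∘ (blockEquiv h).symm))) : f = g := by
  refine PiTensorProduct.ext (MultilinearMap.ext fun v => ?_)
  have := hfg (v ∘ blockEquiv h)
  rwa [Function.comp_assoc, Equiv.self_comp_symm] at this

/-- Linear maps out of a tensor product of tensor powers agree if they agree on pure tensors. -/
theorem block_ext' {f g : (⨂[k]^a M) ⊗[k] (⨂[k]^b N) →ₗ[k] P}
    (hfg : ∀ v w, f (PiTensorProduct.tprod k v ⊗ₜ PiTensorProduct.tprod k w) =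
      g (PiTensorProduct.tprod k v ⊗ₜ PiTensorProduct.tprod k w)) : f = g := by
  refine TensorProduct.ext' fun x y => ?_
  induction x using tens_ind with
  | hs c x h => simp only [map_smul, ← TensorProduct.smul_tmul', h]
  | ha x x' h h' => simp only [map_add, TensorProduct.add_tmul, h, h']
  | h v =>
    induction y using tens_ind with
    | hs c x h => simp only [map_smul, TensorProduct.tmul_smul, h]
    | ha x x' h h' => simp only [map_add, TensorProduct.tmul_add, h, h']
    | h w => exact hfg v w

theorem blockPerm_sumCongr (h : a + b = d) (σ : Equiv.Perm (Fin a)) (τ : Equiv.Perm (Fin b))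
    (t : (⨂[k]^a M) ⊗[k] (⨂[k]^b M)) :
    blockPerm k h M (Equiv.sumCongr σ τ) (concatT k h M t) =
      concatT k h M (TensorProduct.map (permT k a M σ) (permT k b M τ) t) := by
  rw [← LinearEquiv.coe_coe, ← LinearMap.comp_apply, ← LinearMap.comp_apply]
  refine LinearMap.congr_fun (block_ext' fun v w => ?_) t
  simp only [LinearMap.comp_apply, LinearEquiv.coe_coe, TensorProduct.map_tmul, permT_tprod]
  have h1 := concatT_tprod_elim (k := k) h (Sum.elim v w)
  have h2 := concatT_tprod_elim (k := k) h (Sum.elim v w ∘ (Equiv.sumCongr σ τ).symm)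
  rw [Sum.elim_comp_inl, Sum.elim_comp_inr] at h1
  rw [h1, blockPerm_tprod, ← h2]
  rfl

/-- The Young subgroup permutes each block internally, and each block is symmetric. Hence sums over
its left cosets, such as the shuffle product, do not depend on the representatives. -/
theorem blockPerm_concatG (h : a + b = d) {σ : Equiv.Perm (Fin a ⊕ Fin b)}
    (hσ : σ ∈ (Equiv.Perm.sumCongrHom (Fin a) (Fin b)).range)
    (z : Gamma k a M ⊗[k] Gamma k b M) :
    blockPerm k h M σ (concatG k h M z) = concatG k h M z := by
  obtain ⟨⟨σ, τ⟩, rfl⟩ := hσ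
  simp only [concatG, LinearMap.comp_apply, LinearEquiv.coe_coe, Equiv.Perm.sumCongrHom_apply]
  refine (blockPerm_sumCongr h σ τ _).trans ?_
  rw [← LinearMap.comp_apply (TensorProduct.map _ _), ← TensorProduct.map_comp]
  have h1 : permT k a M σ ∘ₗ (Gamma k a M).subtype = (Gamma k a M).subtype :=
    LinearMap.ext fun t => t.2 σ
  have h2 : permT k b M τ ∘ₗ (Gamma k b M).subtype = (Gamma k b M).subtype :=
    LinearMap.ext fun t => t.2 τ
  rw [h1, h2]

/-! ### The shuffle product on symmetric tensors -/

theorem blockPerm_out (h : a + b = d) (σ : Equiv.Perm (Fin a ⊕ Fin b))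
    (z : Gamma k a M ⊗[k] Gamma k b M) :
    blockPerm k h M (Quotient.out (σ : Equiv.Perm.ModSumCongr (Fin a) (Fin b)))
      (concatG k h M z) = blockPerm k h M σ (concatG k h M z) := by
  obtain ⟨τ, hτ⟩ := QuotientGroup.mk_out_eq_mul
    (Equiv.Perm.sumCongrHom (Fin a) (Fin b)).range σ
  rw [hτ, blockPerm_mul, blockPerm_concatG h τ.2]

/-- The shuffle product `Γ^a M ⊗ Γ^b M → Γ^d M` for `a + b = d`. -/
noncomputable def shuffle (k : Type u) [CommRing k] (h : a + b = d) (M : Type u)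
    [AddCommGroup M] [Module k M] : Gamma k a M ⊗[k] Gamma k b M →ₗ[k] Gamma k d M :=
  LinearMap.codRestrict (Gamma k d M)
    (∑ q : Equiv.Perm.ModSumCongr (Fin a) (Fin b),
      blockPerm k h M (Quotient.out q) ∘ₗ concatG k h M) fun z σ => by
    obtain ⟨σ, rfl⟩ := (blockEquiv h).permCongr.surjective σ
    change blockPerm k h M σ _ = _
    simp only [LinearMap.sum_apply, map_sum, LinearMap.comp_apply, ← blockPerm_mul]
    -- Left multiplication by `σ` permutes the cosets, and `blockPerm_out` absorbs the change of
    -- representatives.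
    refine Fintype.sum_equiv (MulAction.toPerm σ) _ _ fun q => ?_
    rw [← blockPerm_out, MulAction.toPerm_apply]
    congr 3
    conv_rhs => rw [← QuotientGroup.out_eq' q]
    rfl

theorem shuffle_coe (h : a + b = d) (z : Gamma k a M ⊗[k] Gamma k b M) :
    (shuffle k h M z : ⨂[k]^d M) = ∑ q : Equiv.Perm.ModSumCongr (Fin a) (Fin b),
      blockPerm k h M (Quotient.out q) (concatG k h M z) :=
  LinearMap.sum_apply _ _ _

theorem bilT_blockPerm_of_mem (h : a + b = d) (B : M →ₗ[k] N →ₗ[k] P)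
    (σ : Equiv.Perm (Fin a ⊕ Fin b)) (x : Gamma k d M) (y : ⨂[k]^d N) :
    bilT k d B x.1 (blockPerm k h N σ y) = blockPerm k h P σ (bilT k d B x.1 y) := by
  conv_lhs => rw [← x.2 ((blockEquiv h).permCongr σ)]
  exact bilT_blockPerm h B σ x.1 y

/-- Applying a bilinear map distributes over the shuffle product. -/
theorem bilG_shuffle [Module.Finite k M] [Module.Projective k M]
    (h : a + b = d) (B : M →ₗ[k] N →ₗ[k] P)
    (x : Gamma k d M) (z : Gamma k a N ⊗[k] Gamma k b N) :
    bilG k d B x (shuffle k h N z) =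
      shuffle k h P (TensorProduct.map₂ (bilG k a B) (bilG k b B) (comulG k M h x) z) := by
  apply Subtype.ext
  rw [bilG_coe, shuffle_coe, shuffle_coe, map_sum]
  refine Finset.sum_congr rfl fun q _ => ?_
  -- Being invariant, `x` commutes with every permutation, so it acts on the unshuffled tensor, and
  -- there it acts as its comultiplication.
  rw [bilT_blockPerm_of_mem, ← concatG_bil, concatG_comulG]

/-! ### Products and coproducts of exterior powers -/

/-- The multiplication `Λ^a M ⊗ Λ^b M → Λ^d M` for `a + b = d`. -/
noncomputable def extMul (k : Type u) [CommRing k] (h : a + b = d) (M : Type u)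
    [AddCommGroup M] [Module k M] : (⋀[k]^a M) ⊗[k] (⋀[k]^b M) →ₗ[k] ⋀[k]^d M :=
  TensorProduct.lift (LinearMap.mk₂ k
    (fun x y => ⟨x.1 * y.1, h ▸ SetLike.mul_mem_graded x.2 y.2⟩)
    (fun _ _ _ => Subtype.ext (add_mul _ _ _))
    (fun _ _ _ => Subtype.ext (smul_mul_assoc _ _ _))
    (fun _ _ _ => Subtype.ext (mul_add _ _ _))
    (fun _ _ _ => Subtype.ext (mul_smul_comm _ _ _)))

theorem extMul_wedge (h : a + b = d) (t : (⨂[k]^a M) ⊗[k] (⨂[k]^b M)) :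
    extMul k h M (TensorProduct.map (wedge k a M) (wedge k b M) t) =
      wedge k d M (concatT k h M t) := by
  rw [← LinearEquiv.coe_coe, ← LinearMap.comp_apply, ← LinearMap.comp_apply]
  refine LinearMap.congr_fun (block_ext' fun v w => ?_) t
  apply Subtype.ext
  subst h
  simp only [LinearMap.comp_apply, LinearEquiv.coe_coe, TensorProduct.map_tmul, concatT_tprod,
    wedge_tprod, extMul, TensorProduct.lift.tmul, LinearMap.mk₂_apply,
    exteriorPower.ιMulti_apply_coe, ExteriorAlgebra.ιMulti_apply, Fin.cast_eq_self]
  rw [← List.prod_append, ← List.ofFn_fin_append]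
  congr 2
  funext i
  refine Fin.addCases (fun j => ?_) (fun j => ?_) i <;> simp

/-- The comultiplication `Λ^d M → Λ^a M ⊗ Λ^b M` for `a + b = d`. -/
noncomputable def extComul (k : Type u) [CommRing k] (h : a + b = d) (M : Type u)
    [AddCommGroup M] [Module k M] : (⋀[k]^d M) →ₗ[k] (⋀[k]^a M) ⊗[k] (⋀[k]^b M) :=
  exteriorPower.alternatingMapLinearEquiv (N := (⋀[k]^a M) ⊗[k] (⋀[k]^b M))
    (((exteriorPower.ιMulti k a (M := M)).domCoprod (exteriorPower.ιMulti k b (M := M))).domDomCongr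
      (blockEquiv h))

/-- The summand of `extComul` given by a permutation. -/
noncomputable def extComulSummand (k : Type u) [CommRing k] (h : a + b = d) (M : Type u)
    [AddCommGroup M] [Module k M] (σ : Equiv.Perm (Fin a ⊕ Fin b)) :
    (⨂[k]^d M) →ₗ[k] (⋀[k]^a M) ⊗[k] (⋀[k]^b M) :=
  TensorProduct.map (wedge k a M) (wedge k b M) ∘ₗ (concatT k h M).symm.toLinearMap ∘ₗ
    -- The inverse appears because `blockPerm` composes index functions with `σ.symm`, whereas the
    -- summands of `domCoprod` evaluate at `x ∘ σ`.
    blockPerm k h M σ⁻¹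

theorem extComul_wedge (h : a + b = d) (t : ⨂[k]^d M) :
    extComul k h M (wedge k d M t) = ∑ q : Equiv.Perm.ModSumCongr (Fin a) (Fin b),
      Equiv.Perm.sign (Quotient.out q) • extComulSummand k h M (Quotient.out q) t := by
  have : extComul k h M ∘ₗ wedge k d M = ∑ q : Equiv.Perm.ModSumCongr (Fin a) (Fin b),
      Equiv.Perm.sign (Quotient.out q) • extComulSummand k h M (Quotient.out q) := by
    refine block_ext (M := M) (N := (⋀[k]^a M) ⊗[k] (⋀[k]^b M)) h fun x => ?_
    rw [LinearMap.comp_apply, wedge_tprod, extComul,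
      exteriorPower.alternatingMapLinearEquiv_apply_ιMulti, AlternatingMap.domDomCongr_apply,
      Function.comp_assoc, Equiv.symm_comp_self, Function.comp_id,
      ← AlternatingMap.coe_multilinearMap,
      AlternatingMap.domCoprod_coe, _root_.sum_apply, LinearMap.sum_apply]
    refine Finset.sum_congr rfl fun q _ => ?_
    conv_lhs => rw [← QuotientGroup.out_eq' q]
    rw [LinearMap.smul_apply, extComulSummand, LinearMap.comp_apply, LinearMap.comp_apply,
      blockPerm_tprod, LinearEquiv.coe_coe, concatT_symm_tprod, TensorProduct.map_tmul,
      wedge_tprod, wedge_tprod]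
    rfl
  rw [← LinearMap.comp_apply, this]
  simp

/-- A symmetric tensor acts on products of exterior powers through its comultiplication. -/
theorem map_wedge_bilT {a b d : ℕ} (h : a + b = d) (V W : GammaP k d)
    (z : Gamma k a (V →ₗ[k] W) ⊗[k] Gamma k b (V →ₗ[k] W))
    (t : (⨂[k]^a V.carrier) ⊗[k] (⨂[k]^b V.carrier)) :
    TensorProduct.map (wedge k a W) (wedge k b W) ((concatT k h W).symm
      (bilT k d LinearMap.id (concatG k h (V →ₗ[k] W) z) (concatT k h V t))) =
      TensorProduct.map₂ (extAct (V.deg a) (W.deg a)) (extAct (V.deg b) (W.deg b)) z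
        (TensorProduct.map (wedge k a V) (wedge k b V) t) := by
  induction z using TensorProduct.induction_on with
  | zero => simp
  | add x x' h h' => simp only [map_add, LinearMap.add_apply, h, h']
  | tmul f g =>
    induction t using TensorProduct.induction_on with
    | zero => simp
    | add x x' h h' => simp only [map_add, h, h']
    | tmul x y =>
      have h1 := concatT_bil (k := k) h LinearMap.id f.1 g.1 x y
      have h2 : concatG k h (V →ₗ[k] W) (f ⊗ₜ g) = concatT k h _ (f.1 ⊗ₜ g.1) := rfl
      rw [h2, h1, LinearEquiv.symm_apply_apply, TensorProduct.map_tmul, TensorProduct.map_tmul,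
        TensorProduct.map₂_apply_tmul, TensorProduct.map_tmul,
        extAct_wedge (V.deg a) (W.deg a), extAct_wedge (V.deg b) (W.deg b)]

/-- The invariance of `f` lets it pass the permutation, so each summand of the comultiplication is
natural by itself and the signs play no role. -/
theorem extComulSummand_bilT (h : a + b = d) (V W : GammaP k d)
    (σ : Equiv.Perm (Fin a ⊕ Fin b))
    (f : Gamma k d (V →ₗ[k] W)) (t : ⨂[k]^d V.carrier) :
    extComulSummand k h W σ (bilT k d LinearMap.id f.1 t) =
      TensorProduct.map₂ (extAct (V.deg a) (W.deg a)) (extAct (V.deg b) (W.deg b))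
        (comulG k (V →ₗ[k] W) h f) (extComulSummand k h V σ t) := by
  simp only [extComulSummand, LinearMap.comp_apply, LinearEquiv.coe_coe]
  rw [← bilT_blockPerm_of_mem, ← concatG_comulG h f, ← map_wedge_bilT,
    LinearEquiv.apply_symm_apply]

/-- The comultiplication of exterior powers is natural in `Γ^d P_k`. -/
theorem extComul_extAct (h : a + b = d) (V W : GammaP k d)
    (f : Gamma k d (V →ₗ[k] W)) (x : ⋀[k]^d V.carrier) :
    extComul k h W (extAct V W f x) =
      TensorProduct.map₂ (extAct (V.deg a) (W.deg a)) (extAct (V.deg b) (W.deg b))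
        (comulG k (V →ₗ[k] W) h f) (extComul k h V x) := by
  obtain ⟨t, rfl⟩ := wedge_surjective x
  rw [extAct_wedge, extComul_wedge, extComul_wedge, map_sum]
  refine Finset.sum_congr rfl fun q _ => ?_
  rw [extComulSummand_bilT, Units.smul_def, Units.smul_def, map_zsmul]

/-- A shuffle product acts on exterior powers via comultiplication, the action of the factors,
and multiplication. -/
theorem extAct_shuffle (h : a + b = d) (V W : GammaP k d)
    (z : Gamma k a (V →ₗ[k] W) ⊗[k] Gamma k b (V →ₗ[k] W)) (x : ⋀[k]^d V.carrier) :
    extAct V W (shuffle k h (V →ₗ[k] W) z) x =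
      extMul k h W (TensorProduct.map₂ (extAct (V.deg a) (W.deg a)) (extAct (V.deg b) (W.deg b))
        z (extComul k h V x)) := by
  obtain ⟨t, rfl⟩ := wedge_surjective x
  rw [extAct_wedge, extComul_wedge, shuffle_coe, map_sum, LinearMap.sum_apply, map_sum, map_sum,
    map_sum]
  refine Finset.sum_congr rfl fun q _ => ?_
  set σ := Quotient.out q
  rw [Units.smul_def, map_zsmul, map_zsmul, ← Units.smul_def]
  simp only [extComulSummand, LinearMap.comp_apply, LinearEquiv.coe_coe]
  -- The sign of `σ` is traded for `σ` acting inside `wedge`. Distributed over both arguments, it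
  -- cancels `σ⁻¹` on `t` and leaves the `σ`-term of the shuffle product.
  rw [← map_wedge_bilT, extMul_wedge, LinearEquiv.apply_symm_apply,
    LinearEquiv.apply_symm_apply, ← wedge_blockPerm h, ← bilT_blockPerm, ← blockPerm_mul,
    mul_inv_cancel, blockPerm_one]

/-! ### Products with one factor in a kernel -/

/-- The span of the tensors all of whose factors are in the kernel of `p`. -/
def kerTensors (d : ℕ) (p : M →ₗ[k] N) : Submodule k (⨂[k]^d M) :=
  Submodule.span k {t | ∃ v : Fin d → M, (∀ i, p (v i) = 0) ∧ t = PiTensorProduct.tprod k v}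

/-- The `d`-th tensor power of a linear map. -/
noncomputable def mapT (d : ℕ) (p : M →ₗ[k] N) : (⨂[k]^d M) →ₗ[k] (⨂[k]^d N) :=
  PiTensorProduct.map fun _ => p

theorem mapT_tprod (p : M →ₗ[k] N) (v : Fin d → M) :
    mapT d p (PiTensorProduct.tprod k v) = PiTensorProduct.tprod k fun i => p (v i) :=
  PiTensorProduct.map_tprod _ _

theorem tprod_mem_kerTensors {p : M →ₗ[k] N} {v : Fin d → M} (hv : ∀ i, p (v i) = 0) :
    PiTensorProduct.tprod k v ∈ kerTensors d p :=
  Submodule.subset_span ⟨v, hv, rfl⟩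

theorem concatT_mem_kerTensors (h : a + b = d) (p : M →ₗ[k] N) {s : ⨂[k]^a M} {t : ⨂[k]^b M}
    (hs : s ∈ kerTensors a p) (ht : t ∈ kerTensors b p) :
    concatT k h M (s ⊗ₜ t) ∈ kerTensors d p := by
  induction hs using Submodule.span_induction with
  | zero => simp
  | add x y _ _ hx hy => rw [TensorProduct.add_tmul, map_add]; exact add_mem hx hy
  | smul c x _ hx => rw [← TensorProduct.smul_tmul', map_smul]; exact Submodule.smul_mem _ _ hx
  | mem x hx =>
    obtain ⟨v, hv, rfl⟩ := hx
    induction ht using Submodule.span_induction with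
    | zero => simp
    | add x y _ _ hx hy => rw [TensorProduct.tmul_add, map_add]; exact add_mem hx hy
    | smul c x _ hx => rw [TensorProduct.tmul_smul, map_smul]; exact Submodule.smul_mem _ _ hx
    | mem x hx =>
      obtain ⟨w, hw, rfl⟩ := hx
      rw [concatT_tprod]
      refine tprod_mem_kerTensors fun i => ?_
      generalize Fin.cast h.symm i = j
      refine Fin.addCases (fun j => ?_) (fun j => ?_) j <;> simp [hv, hw]

theorem permT_mem_kerTensors (σ : Equiv.Perm (Fin d)) (p : M →ₗ[k] N) {t : ⨂[k]^d M}
    (ht : t ∈ kerTensors d p) : permT k d M σ t ∈ kerTensors d p := by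
  induction ht using Submodule.span_induction with
  | zero => simp
  | add x y _ _ hx hy => rw [map_add]; exact add_mem hx hy
  | smul c x _ hx => rw [map_smul]; exact Submodule.smul_mem _ _ hx
  | mem x hx =>
    obtain ⟨v, hv, rfl⟩ := hx
    rw [permT_tprod]
    exact tprod_mem_kerTensors fun i => hv _

theorem shuffle_mem_kerTensors (h : a + b = d) (p : M →ₗ[k] N) {s : Gamma k a M}
    {t : Gamma k b M} (hs : s.1 ∈ kerTensors a p) (ht : t.1 ∈ kerTensors b p) :
    (shuffle k h M (s ⊗ₜ t)).1 ∈ kerTensors d p := by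
  rw [shuffle_coe]
  exact sum_mem fun q _ => permT_mem_kerTensors _ _ (concatT_mem_kerTensors h p hs ht)

/-- By finiteness, a permutation mapping the first block into itself preserves both blocks and so
lies in the Young subgroup. This is applied to the inverse of `σ`. -/
theorem exists_symm_inl_eq_inr {σ : Equiv.Perm (Fin a ⊕ Fin b)}
    (hσ : σ ∉ (Equiv.Perm.sumCongrHom (Fin a) (Fin b)).range) :
    ∃ i j, σ.symm (Sum.inl i) = Sum.inr j := by
  by_contra! hc
  refine hσ (inv_mem_iff.mp (Equiv.Perm.mem_sumCongrHom_range_of_perm_mapsTo_inl ?_))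
  rintro _ ⟨i, rfl⟩
  cases hi : σ.symm (Sum.inl i) with
  | inl j => exact ⟨j, rfl⟩
  | inr j => exact absurd hi (hc i j)

/-- A permutation which mixes the two blocks moves some factor of the second block into the
first one. -/
theorem map_mapT_blockPerm_eq_zero (h : a + b = d) (p : M →ₗ[k] N)
    {σ : Equiv.Perm (Fin a ⊕ Fin b)}
    (hσ : σ ∉ (Equiv.Perm.sumCongrHom (Fin a) (Fin b)).range)
    (s : ⨂[k]^a M) {t : ⨂[k]^b M} (ht : t ∈ kerTensors b p) :
    TensorProduct.map (mapT a p) (LinearMap.id : (⨂[k]^b M) →ₗ[k] _)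
      ((concatT k h M).symm (blockPerm k h M σ (concatT k h M (s ⊗ₜ t)))) = 0 := by
  induction s using tens_ind with
  | hs c x h => rw [← TensorProduct.smul_tmul', map_smul, map_smul, map_smul, map_smul, h, smul_zero]
  | ha x x' h h' =>
    rw [TensorProduct.add_tmul, map_add, map_add, map_add, map_add, h, h', add_zero]
  | h v =>
    induction ht using Submodule.span_induction with
    | zero => simp
    | add x y _ _ hx hy =>
      rw [TensorProduct.tmul_add, map_add, map_add, map_add, map_add, hx, hy, add_zero]
    | smul c x _ hx =>
      rw [TensorProduct.tmul_smul, map_smul, map_smul, map_smul, map_smul, hx, smul_zero]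
    | mem x hx =>
      obtain ⟨w, hw, rfl⟩ := hx
      obtain ⟨i, j, hij⟩ := exists_symm_inl_eq_inr hσ
      have h1 := concatT_tprod_elim (k := k) h (Sum.elim v w)
      rw [Sum.elim_comp_inl, Sum.elim_comp_inr] at h1
      rw [h1, blockPerm_tprod, concatT_symm_tprod, TensorProduct.map_tmul, mapT_tprod,
        MultilinearMap.map_coord_zero _ i, TensorProduct.zero_tmul]
      simp [hij, hw]

/-- The symmetric tensor power of a linear map. -/
noncomputable def mapG (d : ℕ) (p : M →ₗ[k] N) : Gamma k d M →ₗ[k] Gamma k d N :=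
  bilG k d LinearMap.id (constG k d p)

theorem mapG_coe (p : M →ₗ[k] N) (t : Gamma k d M) : (mapG d p t).1 = mapT d p t.1 := by
  change bilT k d LinearMap.id (PiTensorProduct.tprod k fun _ => p) t.1 = _
  -- The invariance of the tensor is forgotten here, so that linearity reduces the claim to pure
  -- tensors.
  generalize t.1 = t
  induction t using tens_ind with
  | hs c x h => rw [map_smul, map_smul, h]
  | ha x x' h h' => rw [map_add, map_add, h, h']
  | h v => rw [bilT_tprod, mapT_tprod]; rfl

/-- Symmetric tensors are a retract of the tensor power, so injectivity survives the tensor product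
and identities in `Γ^a M ⊗ Γ^b N` can be checked in tensor powers. -/
theorem map_subtype_injective [Module.Finite k M] [Module.Projective k M] [Module.Finite k N]
    [Module.Projective k N] :
    Function.Injective (TensorProduct.map (Gamma k a M).subtype (Gamma k b N).subtype) := by
  obtain ⟨r, hr, -, -⟩ := exists_retraction k a M
  obtain ⟨s, hs, -, -⟩ := exists_retraction k b N
  refine LinearMap.injective_of_comp_eq_id _ (TensorProduct.map r s) ?_
  rw [← TensorProduct.map_comp, hr, hs, TensorProduct.map_id]

theorem out_notMem_of_ne_one {q : Equiv.Perm.ModSumCongr (Fin a) (Fin b)}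
    (hq : q ≠ ((1 : Equiv.Perm (Fin a ⊕ Fin b)) : Equiv.Perm.ModSumCongr (Fin a) (Fin b))) :
    Quotient.out q ∉ (Equiv.Perm.sumCongrHom (Fin a) (Fin b)).range := by
  intro hmem
  apply hq
  rw [← QuotientGroup.out_eq' q, QuotientGroup.eq, mul_one, inv_mem_iff]
  exact hmem

theorem out_one_mem : Quotient.out ((1 : Equiv.Perm (Fin a ⊕ Fin b)) :
    Equiv.Perm.ModSumCongr (Fin a) (Fin b)) ∈
      (Equiv.Perm.sumCongrHom (Fin a) (Fin b)).range := by
  obtain ⟨τ, hτ⟩ := QuotientGroup.mk_out_eq_mul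
    (Equiv.Perm.sumCongrHom (Fin a) (Fin b)).range 1
  rw [hτ, one_mul]
  exact τ.2

/-- The shuffle product is a sum over cosets. Outside the trivial coset, some factor of `t` lands in
the first block, where `p` kills it; only the unshuffled term remains. This separates the new factor
from the old ones in the induction. -/
theorem map_mapG_comulG_shuffle [Module.Finite k M] [Module.Projective k M] [Module.Finite k N]
    [Module.Projective k N] (h : a + b = d) (p : M →ₗ[k] N) (s : Gamma k a M)
    {t : Gamma k b M} (ht : t.1 ∈ kerTensors b p) :
    TensorProduct.map (mapG a p) LinearMap.id (comulG k M h (shuffle k h M (s ⊗ₜ t))) =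
      mapG a p s ⊗ₜ t := by
  apply map_subtype_injective
  have h1 (z : Gamma k a M ⊗[k] Gamma k b M) :
      TensorProduct.map (Gamma k a N).subtype (Gamma k b M).subtype
        (TensorProduct.map (mapG a p) LinearMap.id z) =
      TensorProduct.map (mapT a p) LinearMap.id ((concatT k h M).symm (concatG k h M z)) := by
    rw [concatG, LinearMap.comp_apply, LinearEquiv.coe_coe, LinearEquiv.symm_apply_apply,
      ← LinearMap.comp_apply, ← LinearMap.comp_apply, ← TensorProduct.map_comp,
      ← TensorProduct.map_comp]
    congr 2
    exact LinearMap.ext (mapG_coe p)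
  rw [h1, concatG_comulG, shuffle_coe, map_sum, map_sum, Finset.sum_eq_single
    ((1 : Equiv.Perm (Fin a ⊕ Fin b)) : Equiv.Perm.ModSumCongr (Fin a) (Fin b))]
  · rw [blockPerm_concatG h out_one_mem, ← h1]
    rfl
  · exact fun q _ hq => map_mapT_blockPerm_eq_zero h p (out_notMem_of_ne_one hq) s.1 ht
  · exact fun hq => absurd (Finset.mem_univ _) hq

theorem map_wedge (p : M →ₗ[k] N) (t : ⨂[k]^d M) :
    exteriorPower.map d p (wedge k d M t) = wedge k d N (mapT d p t) := by
  induction t using tens_ind with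
  | hs c x h => rw [map_smul, map_smul, map_smul, map_smul, h]
  | ha x x' h h' => rw [map_add, map_add, map_add, map_add, h, h']
  | h v => rw [wedge_tprod, mapT_tprod, wedge_tprod, exteriorPower.map_apply_ιMulti]; rfl

theorem units_smul_tmul (u v : ℤˣ) (x : M) (y : N) :
    (u * v) • ((u • x) ⊗ₜ[k] (v • y)) = x ⊗ₜ[k] y := by
  rcases Int.units_eq_one_or u with rfl | rfl <;> rcases Int.units_eq_one_or v with rfl | rfl <;>
    simp [TensorProduct.neg_tmul, TensorProduct.tmul_neg]

/-- The exterior analogue of `map_mapG_comulG_shuffle`, with the same vanishing of mixed terms; here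
signs have to be tracked as well. -/
theorem map_extComul_extMul (h : a + b = d) (p : M →ₗ[k] N) (x : ⋀[k]^a M)
    {y : ⋀[k]^b M} (hy : y ∈ (kerTensors b p).map (wedge k b M)) :
    TensorProduct.map (exteriorPower.map a p) LinearMap.id
      (extComul k h M (extMul k h M (x ⊗ₜ y))) = exteriorPower.map a p x ⊗ₜ y := by
  obtain ⟨s, rfl⟩ := wedge_surjective x
  obtain ⟨t, ht, rfl⟩ := hy
  have h1 (z : (⨂[k]^a M) ⊗[k] (⨂[k]^b M)) :
      TensorProduct.map (exteriorPower.map a p) LinearMap.id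
        (TensorProduct.map (wedge k a M) (wedge k b M) z) =
      TensorProduct.map (wedge k a N) (wedge k b M)
        (TensorProduct.map (mapT a p) LinearMap.id z) := by
    rw [← LinearMap.comp_apply, ← LinearMap.comp_apply, ← TensorProduct.map_comp,
      ← TensorProduct.map_comp]
    congr 2
    exact LinearMap.ext (map_wedge p)
  rw [← TensorProduct.map_tmul, extMul_wedge, extComul_wedge, map_sum, Finset.sum_eq_single
    ((1 : Equiv.Perm (Fin a ⊕ Fin b)) : Equiv.Perm.ModSumCongr (Fin a) (Fin b))]
  -- The chosen representative of the trivial coset need not be the identity, but it permutes each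
  -- block separately, and the two resulting signs cancel its own.
  · obtain ⟨⟨σ, τ⟩, hστ⟩ := inv_mem (out_one_mem (a := a) (b := b))
    rw [← Equiv.Perm.sign_inv, extComulSummand, ← hστ]
    simp only [LinearMap.comp_apply, LinearEquiv.coe_coe, Equiv.Perm.sumCongrHom_apply]
    have h2 := blockPerm_sumCongr (k := k) h σ τ (s ⊗ₜ[k] t)
    rw [Equiv.Perm.sumCongr]
    erw [h2]
    rw [LinearEquiv.symm_apply_apply, TensorProduct.map_tmul, TensorProduct.map_tmul, wedge_permT,
      wedge_permT, Equiv.Perm.sign_sumCongr]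
    exact congrArg (TensorProduct.map (exteriorPower.map a p) LinearMap.id)
      (units_smul_tmul _ _ (wedge k a M s) (wedge k b M t))
  · intro q _ hq
    rw [Units.smul_def, map_zsmul]
    simp only [extComulSummand, LinearMap.comp_apply, LinearEquiv.coe_coe]
    rw [h1, map_mapT_blockPerm_eq_zero h p (fun hm => out_notMem_of_ne_one hq (inv_mem_iff.mp hm))
      s ht, map_zero, smul_zero]
  · exact fun hq => absurd (Finset.mem_univ _) hq

end Blocks

/-! ### Interchange identities for bilinear maps on tensor powers and tensor products -/

section MultilinearIdentities

variable {k : Type u} [CommRing k] {d : ℕ}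
variable {M N P Q R : Type u} [AddCommGroup M] [Module k M] [AddCommGroup N] [Module k N]
  [AddCommGroup P] [Module k P] [AddCommGroup Q] [Module k Q] [AddCommGroup R] [Module k R]

theorem bilT_interchange (A : P →ₗ[k] Q →ₗ[k] R) (B : M →ₗ[k] N →ₗ[k] P)
    {M' N' S' T' : Type u} [AddCommGroup M'] [Module k M'] [AddCommGroup N'] [Module k N']
    [AddCommGroup S'] [Module k S'] [AddCommGroup T'] [Module k T']
    (C : M' →ₗ[k] N' →ₗ[k] Q) (D : S' →ₗ[k] T' →ₗ[k] R) (E : M →ₗ[k] M' →ₗ[k] S')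
    (F : N →ₗ[k] N' →ₗ[k] T') (h : ∀ x y z w, A (B x y) (C z w) = D (E x z) (F y w))
    (x : ⨂[k]^d M) (y : ⨂[k]^d N) (z : ⨂[k]^d M') (w : ⨂[k]^d N') :
    bilT k d A (bilT k d B x y) (bilT k d C z w) =
      bilT k d D (bilT k d E x z) (bilT k d F y w) := by
  induction x using tens_ind with
  | hs c x h => simp only [map_smul, LinearMap.smul_apply, h]
  | ha x x' h h' => simp only [map_add, LinearMap.add_apply, h, h']
  | h x =>
    induction y using tens_ind with
    | hs c x h => simp only [map_smul, LinearMap.smul_apply, h]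
    | ha x x' h h' => simp only [map_add, LinearMap.add_apply, h, h']
    | h y =>
      induction z using tens_ind with
      | hs c x h => simp only [map_smul, LinearMap.smul_apply, h]
      | ha x x' h h' => simp only [map_add, LinearMap.add_apply, h, h']
      | h z =>
        induction w using tens_ind with
        | hs c x h => simp only [map_smul, h]
        | ha x x' h h' => simp only [map_add, h, h']
        | h w => simp only [bilT_tprod, h]

theorem map₂_interchange {M₁ N₁ P₁ Q₁ R₁ S₁ T₁ U₁ V₁ M₂ N₂ P₂ Q₂ R₂ S₂ T₂ U₂ V₂ : Type u}
    [AddCommGroup M₁] [Module k M₁] [AddCommGroup N₁] [Module k N₁] [AddCommGroup P₁]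
    [Module k P₁] [AddCommGroup Q₁] [Module k Q₁] [AddCommGroup R₁] [Module k R₁]
    [AddCommGroup S₁] [Module k S₁] [AddCommGroup T₁] [Module k T₁] [AddCommGroup U₁]
    [Module k U₁] [AddCommGroup V₁] [Module k V₁]
    [AddCommGroup M₂] [Module k M₂] [AddCommGroup N₂] [Module k N₂] [AddCommGroup P₂]
    [Module k P₂] [AddCommGroup Q₂] [Module k Q₂] [AddCommGroup R₂] [Module k R₂]
    [AddCommGroup S₂] [Module k S₂] [AddCommGroup T₂] [Module k T₂] [AddCommGroup U₂]
    [Module k U₂] [AddCommGroup V₂] [Module k V₂]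
    (A : P₁ →ₗ[k] Q₁ →ₗ[k] R₁) (B : M₁ →ₗ[k] N₁ →ₗ[k] P₁) (C : S₁ →ₗ[k] T₁ →ₗ[k] Q₁)
    (D : U₁ →ₗ[k] V₁ →ₗ[k] R₁) (E : M₁ →ₗ[k] S₁ →ₗ[k] U₁) (F : N₁ →ₗ[k] T₁ →ₗ[k] V₁)
    (A' : P₂ →ₗ[k] Q₂ →ₗ[k] R₂) (B' : M₂ →ₗ[k] N₂ →ₗ[k] P₂) (C' : S₂ →ₗ[k] T₂ →ₗ[k] Q₂)
    (D' : U₂ →ₗ[k] V₂ →ₗ[k] R₂) (E' : M₂ →ₗ[k] S₂ →ₗ[k] U₂) (F' : N₂ →ₗ[k] T₂ →ₗ[k] V₂)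
    (h : ∀ x y z w, A (B x y) (C z w) = D (E x z) (F y w))
    (h' : ∀ x y z w, A' (B' x y) (C' z w) = D' (E' x z) (F' y w))
    (x : M₁ ⊗[k] M₂) (y : N₁ ⊗[k] N₂) (z : S₁ ⊗[k] S₂) (w : T₁ ⊗[k] T₂) :
    TensorProduct.map₂ A A' (TensorProduct.map₂ B B' x y) (TensorProduct.map₂ C C' z w) =
      TensorProduct.map₂ D D' (TensorProduct.map₂ E E' x z) (TensorProduct.map₂ F F' y w) := by
  induction x using TensorProduct.induction_on with
  | zero => simp only [map_zero, LinearMap.zero_apply]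
  | add x x' h h' => simp only [map_add, LinearMap.add_apply, h, h']
  | tmul x x' =>
    induction y using TensorProduct.induction_on with
    | zero => simp only [map_zero, LinearMap.zero_apply]
    | add x x' h h' => simp only [map_add, LinearMap.add_apply, h, h']
    | tmul y y' =>
      induction z using TensorProduct.induction_on with
      | zero => simp only [map_zero, LinearMap.zero_apply]
      | add x x' h h' => simp only [map_add, LinearMap.add_apply, h, h']
      | tmul z z' =>
        induction w using TensorProduct.induction_on with
        | zero => simp only [map_zero]
        | add x x' h h' => simp only [map_add, h, h']
        | tmul w w' => simp only [TensorProduct.map₂_apply_tmul, TensorProduct.map_tmul, h, h']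

theorem map₂_apply_apply_tmul {M₁ N₁ P₁ M₂ N₂ P₂ : Type u}
    [AddCommGroup M₁] [Module k M₁] [AddCommGroup N₁] [Module k N₁] [AddCommGroup P₁]
    [Module k P₁] [AddCommGroup M₂] [Module k M₂] [AddCommGroup N₂] [Module k N₂]
    [AddCommGroup P₂] [Module k P₂] (A : M₁ →ₗ[k] N₁ →ₗ[k] P₁) (B : M₂ →ₗ[k] N₂ →ₗ[k] P₂)
    (z : M₁ ⊗[k] M₂) (y : N₁) (y' : N₂) :
    TensorProduct.map₂ A B z (y ⊗ₜ y') = TensorProduct.map (A.flip y) (B.flip y') z := by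
  induction z using TensorProduct.induction_on with
  | zero => simp only [map_zero, LinearMap.zero_apply]
  | add x x' h h' => simp only [map_add, LinearMap.add_apply, h, h']
  | tmul x x' => simp only [TensorProduct.map₂_apply_tmul, TensorProduct.map_tmul,
      LinearMap.flip_apply]

end MultilinearIdentities

/-! ### The inductive structure behind the isomorphism -/

/-- Structure on a pair of representations `L`, `G` of degree `d` which makes `L` the internal
tensor product of `Λ^d` with `G`, where `G` behaves like a tensor product of `n` divided powers
and `L` like the corresponding tensor product of `n` exterior powers. -/
structure WedgeDatum {k : Type u} [CommRing k] (n d : ℕ) (L G : Rep k d) where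
  /-- The pairing `Λ^d V × G(W) → L(V ⊗ W)`. -/
  pair (V W : GammaP k d) : (⋀[k]^d V.carrier) →ₗ[k] G.ev W →ₗ[k] L.ev (V.tensor W)
  pair_act (V V' W W' : GammaP k d) (α : Gamma k d (V →ₗ[k] V')) (β : Gamma k d (W →ₗ[k] W'))
    (x : ⋀[k]^d V.carrier) (y : G.ev W) :
    pair V' W' (extAct V V' α x) (G.act W W' β y) =
      L.act (V.tensor W) (V'.tensor W')
        (bilG k d (TensorProduct.mapBilinear (RingHom.id k) V W V' W') α β) (pair V W x y)
  /-- The element of `G(W)` given by the divided powers of `n` elements of `W`. -/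
  gen (W : GammaP k d) (w : Fin n → W) : G.ev W
  /-- The morphisms sending `gen` to a given element of `G(W)`. -/
  lift (W₀ W : GammaP k d) (ψ : Fin n → W₀ →ₗ[k] k) : G.ev W →ₗ[k] Gamma k d (W₀ →ₗ[k] W)
  -- For dual families `ψ` and `w`, `lift` splits the Yoneda map of `gen`.
  lift_gen (W₀ W : GammaP k d) (ψ : Fin n → W₀ →ₗ[k] k) (w : Fin n → W₀)
    (hw : ∀ i l, ψ i (w l) = if i = l then 1 else 0) (y : G.ev W) :
    G.act W₀ W (lift W₀ W ψ y) (gen W₀ w) = y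
  -- This and `wedgeMap_mem` only serve the induction: they provide the kernel condition that makes
  -- mixed terms vanish when a further factor is added.
  lift_mem (W₀ W : GammaP k d) (ψ : Fin n → W₀ →ₗ[k] k) (P : Type u) [AddCommGroup P]
    [Module k P] (p : (W₀ →ₗ[k] W) →ₗ[k] P)
    (hp : ∀ i w, p (LinearMap.smulRightₗ (ψ i) w) = 0) (y : G.ev W) :
    (lift W₀ W ψ y).1 ∈ kerTensors d p
  /-- The wedge product of the images of the `n` factors of `L(U)` in exterior powers of `V`. -/
  wedgeMap (U V : GammaP k d) (j : Fin n → U →ₗ[k] V) : L.ev U →ₗ[k] ⋀[k]^d V.carrier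
  wedgeMap_mem (U V : GammaP k d) (j : Fin n → U →ₗ[k] V) (P : Type u) [AddCommGroup P]
    [Module k P] (p : V →ₗ[k] P) (hp : ∀ i u, p (j i u) = 0) (u : L.ev U) :
    wedgeMap U V j u ∈ (kerTensors d p).map (wedge k d V)
  -- The condition on `f` is the one satisfied by evaluation on `V = Hom(W₀, U)`, with `j i u = ψ i
  -- (·) u`.
  act_pair_gen (U V W : GammaP k d) (j : Fin n → U →ₗ[k] V) (w : Fin n → W)
    (f : (V ⊗[k] W) →ₗ[k] U) (hf : ∀ i l u, f (j i u ⊗ₜ w l) = if i = l then u else 0)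
    (u : L.ev U) :
    L.act (V.tensor W) U (constG k d f) (pair V W (wedgeMap U V j u) (gen W w)) = u
  -- In the application `N ≅ Hom(W₀, U)` and `C f a` is the transpose of `f ∘ (V ⊗ a)`. Only the
  -- values of `C` on the maps `ψ i (·) w` matter, since `lift` is built from these.
  wedgeMap_act_pair (U V W W₀ N : GammaP k d) (j : Fin n → U →ₗ[k] N) (ψ : Fin n → W₀ →ₗ[k] k)
    (C : ((V ⊗[k] W) →ₗ[k] U) →ₗ[k] (W₀ →ₗ[k] W) →ₗ[k] (V →ₗ[k] N))
    (hC : ∀ i f w v, C f (LinearMap.smulRightₗ (ψ i) w) v = j i (f (v ⊗ₜ w)))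
    (f : Gamma k d ((V ⊗[k] W) →ₗ[k] U)) (x : ⋀[k]^d V.carrier) (y : G.ev W) :
    wedgeMap U N j (L.act (V.tensor W) U f (pair V W x y)) =
      extAct V N (bilG k d C f (lift W₀ W ψ y)) x

/-! ### The base case: one divided power and one exterior power -/

section Base

variable {k : Type u} [CommRing k] {d : ℕ}

/-- The pairing `Λ^d V × Γ^d W → Λ^d (V ⊗ W)`. -/
noncomputable def wedgePair (V W : GammaP k d) :
    (⋀[k]^d V.carrier) →ₗ[k] Gamma k d W →ₗ[k] ⋀[k]^d (V ⊗[k] W) :=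
  -- Each `w` gives the map `v ↦ v ⊗ w`, so an element of `Γ^d W` becomes a morphism `V → V ⊗ W` of
  -- `Γ^d P_k`. Its action on `Λ^d` makes the pairing well defined.
  (extAct V (V.tensor W) ∘ₗ mapG d (TensorProduct.mk k V W).flip).flip

theorem wedgePair_wedge (V W : GammaP k d) (s : ⨂[k]^d V.carrier) (t : Gamma k d W) :
    wedgePair V W (wedge k d V s) t =
      wedge k d (V ⊗[k] W) (bilT k d (TensorProduct.mk k V W) s t.1) := by
  rw [wedgePair, LinearMap.flip_apply, LinearMap.comp_apply, extAct_wedge, mapG_coe]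
  congr 1
  generalize t.1 = t
  induction s using tens_ind with
  | hs c x h => simp only [map_smul, LinearMap.smul_apply, h]
  | ha x x' h h' => simp only [map_add, LinearMap.add_apply, h, h']
  | h x =>
    induction t using tens_ind with
    | hs c x h => simp only [map_smul, LinearMap.smul_apply, h]
    | ha x x' h h' => simp only [map_add, LinearMap.add_apply, h, h']
    | h y => simp only [mapT_tprod, bilT_tprod]; rfl

theorem extAct_wedgePair_const (V W U : GammaP k d) (f : (V ⊗[k] W) →ₗ[k] U) (w : W)
    (x : ⋀[k]^d V.carrier) :
    extAct (V.tensor W) U (constG k d f) (wedgePair V W x (constG k d w)) =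
      exteriorPower.map d (f ∘ₗ (TensorProduct.mk k V W).flip w) x := by
  obtain ⟨s, rfl⟩ := wedge_surjective x
  rw [wedgePair_wedge, extAct_wedge, map_wedge, constG_coe, constG_coe]
  congr 1
  induction s using tens_ind with
  | hs c x h => simp only [map_smul, LinearMap.smul_apply, h]
  | ha x x' h h' => simp only [map_add, LinearMap.add_apply, h, h']
  | h x => simp only [mapT_tprod, bilT_tprod]; rfl

theorem mapG_smulRight_const (W₀ W : GammaP k d) (ψ : W₀ →ₗ[k] k) (w : W₀) (hw : ψ w = 1)
    (y : Gamma k d W) :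
    bilG k d LinearMap.id (mapG d (LinearMap.smulRightₗ (M := W) ψ) y) (constG k d w) = y := by
  apply Subtype.ext
  rw [bilG_coe, mapG_coe, constG_coe]
  generalize y.1 = y
  induction y using tens_ind with
  | hs c x h => simp only [map_smul, LinearMap.smul_apply, h]
  | ha x x' h h' => simp only [map_add, LinearMap.add_apply, h, h']
  | h x => simp [mapT_tprod, bilT_tprod, hw]

theorem mapT_mem_kerTensors {M N P : Type u} [AddCommGroup M] [Module k M] [AddCommGroup N]
    [Module k N] [AddCommGroup P] [Module k P] (f : M →ₗ[k] N) (p : N →ₗ[k] P)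
    (hp : ∀ x, p (f x) = 0) (t : ⨂[k]^d M) : mapT d f t ∈ kerTensors d p := by
  induction t using tens_ind with
  | hs c x h => rw [map_smul]; exact Submodule.smul_mem _ _ h
  | ha x x' h h' => rw [map_add]; exact add_mem h h'
  | h v => rw [mapT_tprod]; exact tprod_mem_kerTensors fun i => hp _

theorem mapG_mem_kerTensors {M N P : Type u} [AddCommGroup M] [Module k M] [AddCommGroup N]
    [Module k N] [AddCommGroup P] [Module k P] (f : M →ₗ[k] N) (p : N →ₗ[k] P)
    (hp : ∀ x, p (f x) = 0) (t : Gamma k d M) : (mapG d f t).1 ∈ kerTensors d p := by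
  rw [mapG_coe]
  exact mapT_mem_kerTensors f p hp t.1

theorem exteriorPowerMap_mem {M N P : Type u} [AddCommGroup M] [Module k M] [AddCommGroup N]
    [Module k N] [AddCommGroup P] [Module k P] (f : M →ₗ[k] N) (p : N →ₗ[k] P)
    (hp : ∀ x, p (f x) = 0) (x : ⋀[k]^d M) :
    exteriorPower.map d f x ∈ (kerTensors d p).map (wedge k d N) := by
  obtain ⟨t, rfl⟩ := wedge_surjective x
  rw [map_wedge]
  exact Submodule.mem_map_of_mem (mapT_mem_kerTensors f p hp t)

theorem wedgePair_act (V V' W W' : GammaP k d) (α : Gamma k d (V →ₗ[k] V'))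
    (β : Gamma k d (W →ₗ[k] W')) (x : ⋀[k]^d V.carrier) (y : Gamma k d W) :
    wedgePair V' W' (extAct V V' α x) (bilG k d LinearMap.id β y) =
      extAct (V.tensor W) (V'.tensor W')
        (bilG k d (TensorProduct.mapBilinear (RingHom.id k) V W V' W') α β)
          (wedgePair V W x y) := by
  obtain ⟨s, rfl⟩ := wedge_surjective x
  rw [extAct_wedge, wedgePair_wedge, wedgePair_wedge, extAct_wedge, bilG_coe, bilG_coe]
  congr 1
  exact bilT_interchange _ _ _ _ _ _ (fun _ _ _ _ => rfl) _ _ _ _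

/-- On pure tensors, both sides are the wedge of the vectors `j (f_i (v_i ⊗ w_i))`; `hC` is this
equality in a single tensor factor. -/
theorem map_extAct_wedgePair (U V W W₀ N : GammaP k d) (j : U →ₗ[k] N) (ψ : W₀ →ₗ[k] k)
    (C : ((V ⊗[k] W) →ₗ[k] U) →ₗ[k] (W₀ →ₗ[k] W) →ₗ[k] (V →ₗ[k] N))
    (hC : ∀ f w v, C f (LinearMap.smulRightₗ ψ w) v = j (f (v ⊗ₜ w)))
    (f : Gamma k d ((V ⊗[k] W) →ₗ[k] U)) (x : ⋀[k]^d V.carrier) (y : Gamma k d W) :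
    exteriorPower.map d j (extAct (V.tensor W) U f (wedgePair V W x y)) =
      extAct V N (bilG k d C f (mapG d (LinearMap.smulRightₗ (M := W) ψ) y)) x := by
  obtain ⟨s, rfl⟩ := wedge_surjective x
  rw [wedgePair_wedge, extAct_wedge, map_wedge, extAct_wedge, bilG_coe, mapG_coe]
  congr 1
  generalize f.1 = f
  generalize y.1 = y
  induction s using tens_ind with
  | hs c x h => simp only [map_smul, LinearMap.smul_apply, h]
  | ha x x' h h' => simp only [map_add, LinearMap.add_apply, h, h']
  | h x =>
    induction y using tens_ind with
    | hs c x h => simp only [map_smul, LinearMap.smul_apply, h]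
    | ha x x' h h' => simp only [map_add, LinearMap.add_apply, h, h']
    | h y =>
      induction f using tens_ind with
      | hs c x h => simp only [map_smul, LinearMap.smul_apply, h]
      | ha x x' h h' => simp only [map_add, LinearMap.add_apply, h, h']
      | h f =>
        simp only [mapT_tprod, bilT_tprod, LinearMap.id_apply, hC]
        rfl

theorem exteriorPowerMap_comp_eq_self {M N : Type u} [AddCommGroup M] [Module k M]
    [AddCommGroup N] [Module k N] (f : N →ₗ[k] M) (g : M →ₗ[k] N) (h : ∀ x, f (g x) = x)
    (x : ⋀[k]^d M) : exteriorPower.map d f (exteriorPower.map d g x) = x := by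
  rw [← LinearMap.comp_apply, ← exteriorPower.map_comp,
    show f ∘ₗ g = LinearMap.id from LinearMap.ext h, exteriorPower.map_id, LinearMap.id_apply]

variable (k d) in
/-- The exterior power `Λ^d` and the divided power `Γ^d`. -/
noncomputable def WedgeDatum.base : WedgeDatum 1 d (extPow k d) (divPow k d) where
  pair := wedgePair
  pair_act := wedgePair_act
  gen _ w := constG k d (w 0)
  lift _ W ψ := mapG d (LinearMap.smulRightₗ (M := W) (ψ 0))
  lift_gen W₀ W ψ w hw y := mapG_smulRight_const W₀ W (ψ 0) (w 0) (by simp [hw]) y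
  lift_mem W₀ W ψ P _ _ p hp y := mapG_mem_kerTensors _ p (hp 0) y
  wedgeMap _ _ j := exteriorPower.map d (j 0)
  wedgeMap_mem U V j P _ _ p hp u := exteriorPowerMap_mem (j 0) p (hp 0) u
  act_pair_gen U V W j w f hf u := by
    refine (extAct_wedgePair_const V W U f (w 0) _).trans ?_
    exact exteriorPowerMap_comp_eq_self _ (j 0) (fun u => by simpa using hf 0 0 u) u
  wedgeMap_act_pair U V W W₀ N j ψ C hC f x y :=
    map_extAct_wedgePair U V W W₀ N (j 0) (ψ 0) C (hC 0) f x y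

end Base

/-! ### The induction step: adding one tensor factor -/

section Step

variable {k : Type u} [CommRing k] {a b d n : ℕ} {L G : Rep k b}

theorem extMul_mem {M P : Type u} [AddCommGroup M] [Module k M] [AddCommGroup P] [Module k P]
    (h : a + b = d) (p : M →ₗ[k] P) {x : ⋀[k]^a M} {y : ⋀[k]^b M}
    (hx : x ∈ (kerTensors a p).map (wedge k a M)) (hy : y ∈ (kerTensors b p).map (wedge k b M)) :
    extMul k h M (x ⊗ₜ y) ∈ (kerTensors d p).map (wedge k d M) := by
  obtain ⟨s, hs, rfl⟩ := hx
  obtain ⟨t, ht, rfl⟩ := hy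
  rw [← TensorProduct.map_tmul, extMul_wedge]
  exact Submodule.mem_map_of_mem (concatT_mem_kerTensors h p hs ht)

theorem WedgeDatum.step_pair_act (h : a + b = d) (D : WedgeDatum n b L G)
    (V V' W W' : GammaP k d) (α : Gamma k d (V →ₗ[k] V')) (β : Gamma k d (W →ₗ[k] W'))
    (x : ⋀[k]^d V.carrier) (y : Gamma k a W.carrier ⊗[k] G.ev (W.deg b)) :
    TensorProduct.map₂ (wedgePair (V'.deg a) (W'.deg a)) (D.pair (V'.deg b) (W'.deg b))
      (extComul k h V' (extAct V V' α x))
      (TensorProduct.map₂ (bilG k a LinearMap.id) (G.act (W.deg b) (W'.deg b))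
        (comulG k (W →ₗ[k] W') h β) y) =
    TensorProduct.map₂ (extAct ((V.deg a).tensor (W.deg a)) ((V'.deg a).tensor (W'.deg a)))
      (L.act ((V.deg b).tensor (W.deg b)) ((V'.deg b).tensor (W'.deg b)))
      (comulG k _ h (bilG k d (TensorProduct.mapBilinear (RingHom.id k) V W V' W') α β))
      (TensorProduct.map₂ (wedgePair (V.deg a) (W.deg a)) (D.pair (V.deg b) (W.deg b))
        (extComul k h V x) y) := by
  rw [extComul_extAct, comulG_bil]
  exact map₂_interchange _ _ _ _ _ _ _ _ _ _ _ _
    (fun x y z w => wedgePair_act (V.deg a) (V'.deg a) (W.deg a) (W'.deg a) x z y w)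
    (fun x y z w => D.pair_act (V.deg b) (V'.deg b) (W.deg b) (W'.deg b) x z y w) _ _ _ _

/-- Evaluation at `w 0` kills everything lifted from the later factors, because `ψ i.succ (w 0) =
0`. So the comultiplication of the shuffle product contributes only its unshuffled term, and the
claim splits into the base case and the one for `D`. -/
theorem WedgeDatum.step_lift_gen (h : a + b = d) (D : WedgeDatum n b L G)
    (W₀ W : GammaP k d) (ψ : Fin (n + 1) → W₀ →ₗ[k] k) (w : Fin (n + 1) → W₀)
    (hw : ∀ i l, ψ i (w l) = if i = l then 1 else 0)
    (y : Gamma k a W.carrier ⊗[k] G.ev (W.deg b)) :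
    TensorProduct.map₂ (bilG k a LinearMap.id) (G.act (W₀.deg b) (W.deg b))
      (comulG k (W₀ →ₗ[k] W) h (shuffle k h (W₀ →ₗ[k] W)
        (TensorProduct.map (mapG a (LinearMap.smulRightₗ (M := W) (ψ 0)))
          (D.lift (W₀.deg b) (W.deg b) fun i => ψ i.succ) y)))
      (constG k a (w 0) ⊗ₜ D.gen (W₀.deg b) fun i => w i.succ) = y := by
  induction y using TensorProduct.induction_on with
  | zero => simp only [map_zero, LinearMap.zero_apply]
  | add x y hx hy => simp only [map_add, LinearMap.add_apply, hx, hy]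
  | tmul s t =>
    have h1 : (bilG k a (LinearMap.id : (W₀ →ₗ[k] W) →ₗ[k] _)).flip (constG k a (w 0)) =
        mapG a (LinearMap.applyₗ (w 0)) := by
      refine LinearMap.ext fun x => Subtype.ext ?_
      rw [mapG_coe, LinearMap.flip_apply, bilG_coe, constG_coe]
      generalize x.1 = x
      induction x using tens_ind with
      | hs c x h => simp only [map_smul, LinearMap.smul_apply, h]
      | ha x x' h h' => simp only [map_add, LinearMap.add_apply, h, h']
      | h x => simp only [mapT_tprod, bilT_tprod]; rfl
    have h2 := map_mapG_comulG_shuffle h (LinearMap.applyₗ (w 0) : (W₀ →ₗ[k] W) →ₗ[k] W)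
      (mapG a (LinearMap.smulRightₗ (M := W) (ψ 0)) s)
      (D.lift_mem (W₀.deg b) (W.deg b) (fun i => ψ i.succ) W (LinearMap.applyₗ (w 0))
        (fun i w' => by simp [hw]) t)
    -- Evaluation in the first block is split off from the action on the second, so that `h2`
    -- applies while the second block is still untouched.
    rw [map₂_apply_apply_tmul, h1, ← LinearMap.comp_id ((G.act (W₀.deg b) (W.deg b)).flip _),
      ← LinearMap.id_comp (mapG a (LinearMap.applyₗ (w 0))), TensorProduct.map_comp,
      LinearMap.comp_apply, TensorProduct.map_tmul]
    erw [h2]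
    rw [TensorProduct.map_tmul, LinearMap.flip_apply]
    congr 1
    · rw [LinearMap.id_apply, ← h1]
      exact mapG_smulRight_const (W₀.deg a) (W.deg a) (ψ 0) (w 0) (by simp [hw]) s
    · exact D.lift_gen (W₀.deg b) (W.deg b) (fun i => ψ i.succ) (fun i => w i.succ)
        (fun i l => by simp [hw]) t

theorem WedgeDatum.step_lift_mem (h : a + b = d) (D : WedgeDatum n b L G)
    (W₀ W : GammaP k d) (ψ : Fin (n + 1) → W₀ →ₗ[k] k) {P : Type u} [AddCommGroup P]
    [Module k P] (p : (W₀ →ₗ[k] W) →ₗ[k] P)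
    (hp : ∀ i w, p (LinearMap.smulRightₗ (ψ i) w) = 0)
    (y : Gamma k a W.carrier ⊗[k] G.ev (W.deg b)) :
    (shuffle k h (W₀ →ₗ[k] W) (TensorProduct.map (mapG a (LinearMap.smulRightₗ (M := W) (ψ 0)))
      (D.lift (W₀.deg b) (W.deg b) fun i => ψ i.succ) y)).1 ∈ kerTensors d p := by
  induction y using TensorProduct.induction_on with
  | zero => rw [map_zero, map_zero]; exact zero_mem _
  | add x y hx hy => rw [map_add, map_add]; exact add_mem hx hy
  | tmul s t =>
    exact shuffle_mem_kerTensors h p (mapG_mem_kerTensors _ p (hp 0) s)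
      (D.lift_mem (W₀.deg b) (W.deg b) _ P p (fun i => hp i.succ) t)

theorem WedgeDatum.step_wedgeMap_mem (h : a + b = d) (D : WedgeDatum n b L G)
    (U V : GammaP k d) (j : Fin (n + 1) → U →ₗ[k] V) {P : Type u} [AddCommGroup P]
    [Module k P] (p : V →ₗ[k] P) (hp : ∀ i u, p (j i u) = 0)
    (u : (⋀[k]^a U.carrier) ⊗[k] L.ev (U.deg b)) :
    extMul k h V (TensorProduct.map (exteriorPower.map a (j 0))
      (D.wedgeMap (U.deg b) (V.deg b) fun i => j i.succ) u) ∈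
        (kerTensors d p).map (wedge k d V) := by
  induction u using TensorProduct.induction_on with
  | zero => rw [map_zero, map_zero]; exact zero_mem _
  | add x y hx hy => rw [map_add, map_add]; exact add_mem hx hy
  | tmul s t =>
    exact extMul_mem h p (exteriorPowerMap_mem _ p (hp 0) s)
      (D.wedgeMap_mem (U.deg b) (V.deg b) _ P p (fun i => hp i.succ) t)

/-- The argument is that of `step_lift_gen`: the map `v ↦ f (v ⊗ w 0)` on the first block kills the
images of all `j i.succ`, so mixed terms of the comultiplied wedge product vanish. -/
theorem WedgeDatum.step_act_pair_gen (h : a + b = d) (D : WedgeDatum n b L G)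
    (U V W : GammaP k d) (j : Fin (n + 1) → U →ₗ[k] V) (w : Fin (n + 1) → W)
    (f : (V ⊗[k] W) →ₗ[k] U) (hf : ∀ i l u, f (j i u ⊗ₜ w l) = if i = l then u else 0)
    (u : (⋀[k]^a U.carrier) ⊗[k] L.ev (U.deg b)) :
    TensorProduct.map₂ (extAct ((V.deg a).tensor (W.deg a)) (U.deg a))
      (L.act ((V.deg b).tensor (W.deg b)) (U.deg b)) (comulG k _ h (constG k d f))
      (TensorProduct.map₂ (wedgePair (V.deg a) (W.deg a)) (D.pair (V.deg b) (W.deg b))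
        (extComul k h V (extMul k h V (TensorProduct.map (exteriorPower.map a (j 0))
          (D.wedgeMap (U.deg b) (V.deg b) fun i => j i.succ) u)))
        (constG k a (w 0) ⊗ₜ D.gen (W.deg b) fun i => w i.succ)) = u := by
  induction u using TensorProduct.induction_on with
  | zero => simp only [map_zero, LinearMap.zero_apply]
  | add x y hx hy => simp only [map_add, LinearMap.add_apply, hx, hy]
  | tmul s t =>
    have h1 : extAct ((V.deg a).tensor (W.deg a)) (U.deg a) (constG k a f) ∘ₗ
        (wedgePair (V.deg a) (W.deg a)).flip (constG k a (w 0)) =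
        exteriorPower.map a (f ∘ₗ (TensorProduct.mk k V W).flip (w 0)) :=
      LinearMap.ext fun x => extAct_wedgePair_const (V.deg a) (W.deg a) (U.deg a) f (w 0) x
    have h2 := map_extComul_extMul h (f ∘ₗ (TensorProduct.mk k V W).flip (w 0))
      (exteriorPower.map a (j 0) s)
      (D.wedgeMap_mem (U.deg b) (V.deg b) (fun i => j i.succ) U
        (f ∘ₗ (TensorProduct.mk k V W).flip (w 0))
        (fun i u => by simp [hf]) t)
    rw [comulG_const, TensorProduct.map₂_apply_tmul, map₂_apply_apply_tmul,
      ← LinearMap.comp_apply (TensorProduct.map _ _), ← TensorProduct.map_comp, h1,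
      ← LinearMap.comp_id (_ ∘ₗ (D.pair (V.deg b) (W.deg b)).flip _),
      ← LinearMap.id_comp (exteriorPower.map a _), TensorProduct.map_comp,
      LinearMap.comp_apply, TensorProduct.map_tmul]
    erw [h2]
    rw [TensorProduct.map_tmul]
    congr 1
    · exact exteriorPowerMap_comp_eq_self _ (j 0) (fun u => by simpa using hf 0 0 u) s
    · exact D.act_pair_gen (U.deg b) (V.deg b) (W.deg b) (fun i => j i.succ)
        (fun i => w i.succ) f (fun i l u => by simp [hf]) t

/-- By `bilG_shuffle` and `extAct_shuffle`, the right side also becomes a product of contributions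
of the two blocks, after comultiplying `f` and `x`. No mixed terms have to vanish here, and the two
blocks are compared separately. -/
theorem WedgeDatum.step_wedgeMap_act_pair (h : a + b = d) (D : WedgeDatum n b L G)
    (U V W W₀ N : GammaP k d) (j : Fin (n + 1) → U →ₗ[k] N)
    (ψ : Fin (n + 1) → W₀ →ₗ[k] k)
    (C : ((V ⊗[k] W) →ₗ[k] U) →ₗ[k] (W₀ →ₗ[k] W) →ₗ[k] (V →ₗ[k] N))
    (hC : ∀ i f w v, C f (LinearMap.smulRightₗ (ψ i) w) v = j i (f (v ⊗ₜ w)))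
    (f : Gamma k d ((V ⊗[k] W) →ₗ[k] U)) (x : ⋀[k]^d V.carrier)
    (y : Gamma k a W.carrier ⊗[k] G.ev (W.deg b)) :
    extMul k h N (TensorProduct.map (exteriorPower.map a (j 0))
      (D.wedgeMap (U.deg b) (N.deg b) fun i => j i.succ)
      (TensorProduct.map₂ (extAct ((V.deg a).tensor (W.deg a)) (U.deg a))
        (L.act ((V.deg b).tensor (W.deg b)) (U.deg b)) (comulG k _ h f)
        (TensorProduct.map₂ (wedgePair (V.deg a) (W.deg a)) (D.pair (V.deg b) (W.deg b))
          (extComul k h V x) y))) =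
    extAct V N (bilG k d C f (shuffle k h (W₀ →ₗ[k] W)
      (TensorProduct.map (mapG a (LinearMap.smulRightₗ (M := W) (ψ 0)))
        (D.lift (W₀.deg b) (W.deg b) fun i => ψ i.succ) y))) x := by
  rw [bilG_shuffle, extAct_shuffle]
  congr 1
  generalize comulG k _ h f = f
  generalize extComul k h V x = x
  induction y using TensorProduct.induction_on with
  | zero => simp only [map_zero, LinearMap.zero_apply]
  | add x y hx hy => simp only [map_add, LinearMap.add_apply, hx, hy]
  | tmul y y' =>
    induction x using TensorProduct.induction_on with
    | zero => simp only [map_zero, LinearMap.zero_apply]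
    | add x y hx hy => simp only [map_add, LinearMap.add_apply, hx, hy]
    | tmul x x' =>
      induction f using TensorProduct.induction_on with
      | zero => simp only [map_zero, LinearMap.zero_apply]
      | add x y hx hy => simp only [map_add, LinearMap.add_apply, hx, hy]
      | tmul f f' =>
        simp only [TensorProduct.map₂_apply_tmul, TensorProduct.map_tmul]
        congr 1
        · exact map_extAct_wedgePair (U.deg a) (V.deg a) (W.deg a) (W₀.deg a) (N.deg a) (j 0)
            (ψ 0) C (hC 0) f x y
        · exact D.wedgeMap_act_pair (U.deg b) (V.deg b) (W.deg b) (W₀.deg b) (N.deg b)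
            (fun i => j i.succ) (fun i => ψ i.succ) C (fun i => hC i.succ) f' x' y'

/-- The tensor product of `Λ^a` and `L` and the tensor product of `Γ^a` and `G`. -/
noncomputable def WedgeDatum.step (h : a + b = d) (D : WedgeDatum n b L G) :
    WedgeDatum (n + 1) d (extTensor h (extPow k a) L) (extTensor h (divPow k a) G) where
  pair V W := TensorProduct.map₂ (wedgePair (V.deg a) (W.deg a)) (D.pair (V.deg b) (W.deg b)) ∘ₗ
    extComul k h V
  pair_act := D.step_pair_act h
  gen W w := constG k a (w 0) ⊗ₜ D.gen (W.deg b) fun i => w i.succ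
  lift W₀ W ψ := shuffle k h (W₀ →ₗ[k] W) ∘ₗ
    TensorProduct.map (mapG a (LinearMap.smulRightₗ (M := W) (ψ 0)))
      (D.lift (W₀.deg b) (W.deg b) fun i => ψ i.succ)
  lift_gen := D.step_lift_gen h
  lift_mem W₀ W ψ _ _ _ := D.step_lift_mem h W₀ W ψ
  wedgeMap U V j := extMul k h V ∘ₗ TensorProduct.map (exteriorPower.map a (j 0))
    (D.wedgeMap (U.deg b) (V.deg b) fun i => j i.succ)
  wedgeMap_mem U V j _ _ _ := D.step_wedgeMap_mem h U V j
  act_pair_gen := D.step_act_pair_gen h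
  wedgeMap_act_pair := D.step_wedgeMap_act_pair h

end Step

/-! ### The structure for arbitrary weights -/

variable (k : Type u) [CommRing k]

/-- The structure for a sequence of non-negative integers. -/
noncomputable def wedgeDatumSeq : ∀ (n d : ℕ) (lam : Fin (n + 1) → ℕ) (h : ∑ i, lam i = d),
    WedgeDatum (n + 1) d (tensorSeq (extPow k) (n + 1) d lam h)
      (tensorSeq (divPow k) (n + 1) d lam h)
  -- For a one-term sequence `tensorSeq` is the bare functor of degree `d`, so the induction starts
  -- there and no unit factor occurs.
  | 0, d, _, _ => WedgeDatum.base k d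
  | n + 1, _, lam, h =>
    WedgeDatum.step ((Fin.sum_univ_succ lam).symm.trans h)
      (wedgeDatumSeq n _ (fun i => lam i.succ) rfl)

/-! ### Identification of the coend -/

section DayConvolution

variable {k : Type u} [CommRing k] {n d : ℕ} {L G : Rep k d}

/-- The map `Hom(V ⊗ W, U) ⊗ Λ^d V ⊗ G(W) → L(U)` on the direct sum over all `V` and `W`. -/
noncomputable def WedgeDatum.fromDaySum (D : WedgeDatum n d L G) (U : GammaP k d) :
    DaySum (extPow k d) G U →ₗ[k] L.ev U := by
  classical
  exact DirectSum.toModule k _ _ fun p => TensorProduct.lift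
    (LinearMap.lcomp k (L.ev U) (TensorProduct.lift (D.pair (p.1.toP d) (p.2.toP d))) ∘ₗ
      L.act ((p.1.toP d).tensor (p.2.toP d)) U)

theorem WedgeDatum.fromDaySum_dayOf (D : WedgeDatum n d L G) (U : GammaP k d) (V W : SmallP k)
    (f : (V.toP d).tensor (W.toP d) ⟶ U) (x : (extPow k d).ev (V.toP d))
    (y : G.ev (W.toP d)) :
    D.fromDaySum U (dayOf (extPow k d) G U V W f x y) =
      L.act ((V.toP d).tensor (W.toP d)) U f (D.pair (V.toP d) (W.toP d) x y) := by
  classical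
  rw [fromDaySum, dayOf]
  erw [DirectSum.toModule_lof]
  rfl

/-- The coend relations hold in `L(U)` because the pairing is natural in both variables. -/
theorem WedgeDatum.dayRel_le_ker (D : WedgeDatum n d L G) (U : GammaP k d) :
    dayRel (extPow k d) G U ≤ LinearMap.ker (D.fromDaySum U) := by
  refine Submodule.span_le.mpr ?_
  rintro _ ⟨V, V', W, W', α, β, f, x, y, rfl⟩
  rw [SetLike.mem_coe, LinearMap.mem_ker, map_sub, sub_eq_zero, D.fromDaySum_dayOf,
    D.fromDaySum_dayOf]
  refine (LinearMap.congr_fun (L.act_comp ((V.toP d).tensor (W.toP d))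
    ((V'.toP d).tensor (W'.toP d)) U f (GammaP.tensorHom α β)) _).trans ?_
  exact congrArg _ (D.pair_act _ _ _ _ α β x y).symm

/-- The map from the internal tensor product of `Λ^d` and `G` to `L`. -/
noncomputable def WedgeDatum.fromDay (D : WedgeDatum n d L G) (U : GammaP k d) :
    DayObj (extPow k d) G U →ₗ[k] L.ev U :=
  Submodule.liftQ _ (D.fromDaySum U) (D.dayRel_le_ker U)

theorem WedgeDatum.fromDay_mk (D : WedgeDatum n d L G) (U : GammaP k d) (V W : SmallP k)
    (f : (V.toP d).tensor (W.toP d) ⟶ U) (x : (extPow k d).ev (V.toP d))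
    (y : G.ev (W.toP d)) :
    D.fromDay U ((dayRel (extPow k d) G U).mkQ (dayOf (extPow k d) G U V W f x y)) =
      L.act ((V.toP d).tensor (W.toP d)) U f (D.pair (V.toP d) (W.toP d) x y) := by
  rw [fromDay, Submodule.mkQ_apply, Submodule.liftQ_apply, D.fromDaySum_dayOf]

theorem WedgeDatum.fromDay_naturality (D : WedgeDatum n d L G) (U U' : GammaP k d)
    (g : U ⟶ U') :
    D.fromDay U' ∘ₗ dayAct (extPow k d) G U U' g = L.act U U' g ∘ₗ D.fromDay U := by
  refine Submodule.linearMap_qext _ (daySum_ext _ _ fun V W f x y => ?_)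
  rw [LinearMap.comp_apply, LinearMap.comp_apply, LinearMap.comp_apply, LinearMap.comp_apply,
    dayAct_mk, D.fromDay_mk, D.fromDay_mk]
  exact LinearMap.congr_fun (L.act_comp ((V.toP d).tensor (W.toP d)) U U' g f) _

/-- The defining relation of the coend. -/
theorem day_relation (X Y : Rep k d) (U : GammaP k d) {V V' W W' : SmallP k}
    (α : V.toP d ⟶ V'.toP d) (β : W.toP d ⟶ W'.toP d)
    (f : (V'.toP d).tensor (W'.toP d) ⟶ U) (x : X.ev (V.toP d)) (y : Y.ev (W.toP d)) :
    (dayRel X Y U).mkQ (dayOf X Y U V W (GammaP.tensorHom α β ≫ f) x y) =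
      (dayRel X Y U).mkQ (dayOf X Y U V' W' f (X.obj.map α x) (Y.obj.map β y)) := by
  rw [← sub_eq_zero, ← map_sub, Submodule.mkQ_apply, Submodule.Quotient.mk_eq_zero]
  exact Submodule.subset_span ⟨V, V', W, W', α, β, f, x, y, rfl⟩

theorem dayOf_add_left (X Y : Rep k d) (U : GammaP k d) (V W : SmallP k)
    (f : (V.toP d).tensor (W.toP d) ⟶ U) (x x' : X.ev (V.toP d)) (y : Y.ev (W.toP d)) :
    dayOf X Y U V W f (x + x') y = dayOf X Y U V W f x y + dayOf X Y U V W f x' y := by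
  rw [dayOf, TensorProduct.add_tmul, TensorProduct.tmul_add, map_add]
  rfl

theorem dayOf_smul_left (X Y : Rep k d) (U : GammaP k d) (V W : SmallP k)
    (f : (V.toP d).tensor (W.toP d) ⟶ U) (c : k) (x : X.ev (V.toP d)) (y : Y.ev (W.toP d)) :
    dayOf X Y U V W f (c • x) y = c • dayOf X Y U V W f x y := by
  rw [dayOf, ← TensorProduct.smul_tmul', TensorProduct.tmul_smul, map_smul]
  rfl

/-- The object `Hom(V, W)` of `Γ^d P_k`. -/
abbrev GammaP.hom (V W : GammaP k d) : GammaP k d := ⟨V →ₗ[k] W⟩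

/-- For `κ : V₀ ≃ Hom(W₀, U)`, the bilinear map sending `f : V ⊗ W → U` and `a : W₀ → W` to
the map `V → V₀` corresponding to `f ∘ (V ⊗ a)`. -/
noncomputable def curryComp {V W U V₀ W₀ : Type u} [AddCommGroup V] [Module k V]
    [AddCommGroup W] [Module k W] [AddCommGroup U] [Module k U] [AddCommGroup V₀] [Module k V₀]
    [AddCommGroup W₀] [Module k W₀] (κ : V₀ ≃ₗ[k] (W₀ →ₗ[k] U)) :
    ((V ⊗[k] W) →ₗ[k] U) →ₗ[k] (W₀ →ₗ[k] W) →ₗ[k] (V →ₗ[k] V₀) :=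
  LinearMap.mk₂ k (fun f a => κ.symm.toLinearMap ∘ₗ TensorProduct.curry (f ∘ₗ a.lTensor V))
    (fun _ _ _ => by ext; simp; rw [← map_add]; congr 1)
    (fun _ _ _ => by ext; simp; rw [← map_smul]; congr 1)
    (fun _ _ _ => by ext; simp; rw [← map_add]; congr 1; ext; simp)
    (fun _ _ _ => by ext; simp; rw [← map_smul]; congr 1; ext; simp)

theorem curryComp_apply {V W U V₀ W₀ : Type u} [AddCommGroup V] [Module k V]
    [AddCommGroup W] [Module k W] [AddCommGroup U] [Module k U] [AddCommGroup V₀] [Module k V₀]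
    [AddCommGroup W₀] [Module k W₀] (κ : V₀ ≃ₗ[k] (W₀ →ₗ[k] U)) (f : (V ⊗[k] W) →ₗ[k] U)
    (a : W₀ →ₗ[k] W) (v : V) (w : W₀) : κ (curryComp κ f a v) w = f (v ⊗ₜ a w) := by
  simp [curryComp]

/-- The universal property of evaluation, `ev ∘ (c ⊗ W₀) = f ∘ (V ⊗ a)` for the transpose `c` of the
right side, holds for linear maps and hence in each tensor factor. -/
theorem tensorHom_curryComp {V W V₀ W₀ U : GammaP k d} (κ : V₀ ≃ₗ[k] (W₀ →ₗ[k] U))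
    (f : V.tensor W ⟶ U) (a : W₀ ⟶ W) :
    GammaP.tensorHom (V := V) (V' := V₀) (bilG k d (curryComp κ) f a) (𝟙 W₀) ≫
        (show V₀.tensor W₀ ⟶ U from constG k d (TensorProduct.lift κ.toLinearMap)) =
      GammaP.tensorHom (𝟙 V) a ≫ f := by
  apply Subtype.ext
  change bilT k d _ (PiTensorProduct.tprod k _) (bilT k d _ (bilT k d (curryComp κ) f.1 a.1)
    (PiTensorProduct.tprod k _)) =
      bilT k d _ f.1 (bilT k d _ (PiTensorProduct.tprod k _) a.1)
  generalize f.1 = f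
  generalize a.1 = a
  induction f using tens_ind with
  | hs c x h => simp only [map_smul, LinearMap.smul_apply, h]
  | ha x x' h h' => simp only [map_add, LinearMap.add_apply, h, h']
  | h f =>
    induction a using tens_ind with
    | hs c x h => simp only [map_smul, LinearMap.smul_apply, h]
    | ha x x' h h' => simp only [map_add, LinearMap.add_apply, h, h']
    | h a =>
      simp only [bilT_tprod]
      congr 1
      funext i
      refine TensorProduct.ext' fun v w => ?_
      exact curryComp_apply κ (f i) (a i) v w

/-- This is co-Yoneda made explicit: every class `f ⊗ x ⊗ y` can be moved to the single summand
indexed by `Hom(W₀, U)` and `W₀`, with the first factor `ev` and the last factor `gen`. -/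
theorem WedgeDatum.fromDay_bijective (D : WedgeDatum n d L G) (U : GammaP k d) :
    Function.Bijective (D.fromDay U) := by
  -- The coend runs over representatives only, so `k^n` and `Hom(k^n, U)` are replaced by isomorphic
  -- copies `W₀` and `V₀`.
  obtain ⟨W₀, ⟨e⟩⟩ := SmallP.exists_equiv (⟨Fin n → k⟩ : GammaP k d)
  obtain ⟨V₀, ⟨κ⟩⟩ := SmallP.exists_equiv ((W₀.toP d).hom U)
  let ψ : Fin n → W₀.toP d →ₗ[k] k := fun i => LinearMap.proj i ∘ₗ e.toLinearMap
  let w : Fin n → W₀.toP d := fun l => e.symm (Pi.single l 1)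
  have hw (i l) : ψ i (w l) = if i = l then 1 else 0 := by
    simp [ψ, w, Pi.single_apply]
  let j : Fin n → U →ₗ[k] V₀.toP d := fun i =>
    κ.symm.toLinearMap ∘ₗ LinearMap.smulRightₗ (M := U) (ψ i)
  let ev : (V₀.toP d).tensor (W₀.toP d) ⟶ U := constG k d (TensorProduct.lift κ.toLinearMap)
  let F : L.ev U → DayObj (extPow k d) G U := fun u => (dayRel (extPow k d) G U).mkQ
    (dayOf (extPow k d) G U V₀ W₀ ev (D.wedgeMap U (V₀.toP d) j u) (D.gen (W₀.toP d) w))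
  let Fl : L.ev U →ₗ[k] DayObj (extPow k d) G U :=
    { toFun := F
      map_add' := fun u u' => by
        refine (congrArg (Submodule.mkQ _) ?_).trans (map_add (Submodule.mkQ _) _ _)
        exact (congrArg (fun x => dayOf (extPow k d) G U V₀ W₀ ev x _) (map_add _ u u')).trans
          (dayOf_add_left _ _ _ _ _ _ _ _ _)
      map_smul' := fun c u => by
        refine (congrArg (Submodule.mkQ _) ?_).trans (map_smul (Submodule.mkQ _) c _)
        exact (congrArg (fun x => dayOf (extPow k d) G U V₀ W₀ ev x _) (map_smul _ c u)).trans
          (dayOf_smul_left _ _ _ _ _ _ _ _ _) }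
  have h1 (u) : D.fromDay U (Fl u) = u := by
    refine (D.fromDay_mk U V₀ W₀ ev _ _).trans ?_
    refine D.act_pair_gen U (V₀.toP d) (W₀.toP d) j w _ (fun i l u => ?_) u
    simp [j, hw]
  have h2 : Fl ∘ₗ D.fromDay U = LinearMap.id := by
    refine Submodule.linearMap_qext _ (daySum_ext _ _ fun V W f x y => ?_)
    rw [LinearMap.comp_apply, LinearMap.comp_apply, LinearMap.comp_apply, D.fromDay_mk]
    let a : W₀.toP d ⟶ W.toP d := D.lift (W₀.toP d) (W.toP d) ψ y
    have h3 := D.wedgeMap_act_pair U (V.toP d) (W.toP d) (W₀.toP d) (V₀.toP d) j ψ (curryComp κ)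
      (fun i f w v => κ.injective (LinearMap.ext fun w' => by
        rw [curryComp_apply]; simp [j])) f x y
    have h4 : F (L.act ((V.toP d).tensor (W.toP d)) U f (D.pair (V.toP d) (W.toP d) x y)) =
        (dayRel (extPow k d) G U).mkQ (dayOf (extPow k d) G U V₀ W₀ ev
          ((extPow k d).obj.map (X := V.toP d) (Y := V₀.toP d) (bilG k d (curryComp κ) f a) x)
          (G.obj.map (𝟙 (W₀.toP d)) (D.gen (W₀.toP d) w))) := by
      simp only [F]
      rw [h3, G.obj.map_id]
      rfl
    -- The relation is used twice: read backwards, it moves the transpose of `f ∘ (V ⊗ a)` from `x`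
    -- onto `ev`; after `tensorHom_curryComp` it moves `a` onto `gen`, which gives back `y`.
    refine h4.trans ?_
    rw [← day_relation, tensorHom_curryComp, day_relation, (extPow k d).obj.map_id]
    exact congrArg (fun y => (dayRel (extPow k d) G U).mkQ (dayOf (extPow k d) G U V W f x y))
      (D.lift_gen (W₀.toP d) (W.toP d) ψ w hw y)
  exact ⟨Function.LeftInverse.injective (g := Fl) fun z => LinearMap.congr_fun h2 z,
    Function.RightInverse.surjective h1⟩

/-- The isomorphism given by the structure. -/
noncomputable def WedgeDatum.iso (D : WedgeDatum n d L G) :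
    L ≅ internalTensor (extPow k d) G :=
  (ObjectProperty.isoMk _ (NatIso.ofComponents
    (fun U => (LinearEquiv.ofBijective (D.fromDay U) (D.fromDay_bijective U)).toModuleIso)
    (fun {U U'} g => ModuleCat.hom_ext (D.fromDay_naturality U U' g)))).symm

end DayConvolution

end StrictPoly

theorem mainTheorem12 (k : Type u) [CommRing k] (n d : ℕ) (hn : 0 < n) (lam : Fin n → ℕ)
    (hlam : ∑ i, lam i = d) :
    Nonempty (StrictPoly.tensorSeq (StrictPoly.extPow k) n d lam hlam ≅
      StrictPoly.internalTensor (StrictPoly.extPow k d)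
        (StrictPoly.tensorSeq (StrictPoly.divPow k) n d lam hlam)) := by
  obtain ⟨n, rfl⟩ := Nat.exists_eq_add_one.mpr hn
  exact ⟨(StrictPoly.wedgeDatumSeq k n d lam hlam).iso⟩
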